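/- **Theorem (Online CDF estimation lower bound).** In the online comparison feedback model with parameter $n\ge 1$ and horizon $T$, in each round $t=1,\dots,T$ an adversary produces a sample $x_t\in[n+1]=\{1,\dots,n+1\}$ and a (randomized) algorithm, which knows $T$, produces a query $q_t\in[n]$; given the past rounds the two choices are made independently. The algorithm's choices depend only on its past queries and on the feedback bits $1(x_\tau\le q_\tau)$, $\tau<t$. After round $T$ it outputs, based on all its queries and feedback, an estimate $\hat F_T:[n]\to[0,1]$ of the empirical CDF $F_T(i)=\frac1T\sum_{\tau=1}^T 1(x_\tau\le i)$, with error $E(T)=\max_{i\in[n]}|\hat F_T(i)-F_T(i)|$. A stochastic adversary draws $x_1,x_2,\dots$ i.i.d. from a fixed distribution on $[n+1]$ unknown to the algorithm. The fixed-horizon query complexity $T_0(\mathcal A,\varepsilon)\in\mathbb N\cup\{\infty\}$ of an algorithm $\mathcal A$ against stochastic adversaries is the least $T_0$ such that, for every $T>T_0$ and every stochastic adversary, $\Pr[E(T)\le\varepsilon]\ge 3/4$ (and $\infty$ if there is no such $T_0$). 1. There is an absolute constant $c>0$ such that for all $n\ge1$, all $0<\varepsilon\le\frac1{n+1}$ and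 every CDF estimation algorithm $\mathcal A$ with parameter $n$, $$T_0(\mathcal A,\varepsilon)\ \ge\ c\,\frac{n\log n}{\varepsilon^2}.$$ 2. Consequently no CDF estimation algorithm has fixed-horizon query complexity $o(n\log n/\varepsilon^2)$ in the regime $\varepsilon\le\frac1{n+1}$, even against stochastic adversaries: for any sequences $n_k\ge2$ and $0<\varepsilon_k\le\frac1{n_k+1}$ and any algorithms $\mathcal A_k$ with parameter $n_k$, the ratio $T_0(\mathcal A_k,\varepsilon_k)\big/\bigl(n_k\log n_k/\varepsilon_k^2\bigr)$ does not tend to $0$. -/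

import Mathlib

open MeasureTheory Filter Topology
open scoped ENNReal

noncomputable section

namespace ComparisonFeedback

/-- A (randomized) fixed-horizon online CDF estimation algorithm. Queries in `[n] = {1, …, n}` are
elements of `Fin n` and samples in `[n + 1]` are elements of `Fin (n + 1)` (both shifted by one).
The algorithm is told the horizon `T`; what it has seen so far is the list (most recent round
first) of its own queries together with the feedback bits. Given these, `query` is the conditional
law of its next query and `estimate` is the conditional law of its current estimate
`F̂ : [n] → [0, 1]` of the empirical CDF. -/
structure CDFAlgorithm (n : ℕ) where
  query : (T : ℕ) → List (Fin n × Bool) → PMF (Fin n)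
  estimate : (T : ℕ) → List (Fin n × Bool) → ProbabilityMeasure (Fin n → unitInterval)

/-- A (randomized, possibly adaptive) fixed-horizon adversary: given the horizon `T` and the list of
past rounds (sample, query), most recent first, the law of its next sample. -/
def Adversary (n : ℕ) : Type :=
  (T : ℕ) → List (Fin (n + 1) × Fin n) → PMF (Fin (n + 1))

/-- The stochastic adversary, whose samples are i.i.d. from the distribution `D` on `[n + 1]`. -/
def stochasticAdversary {n : ℕ} (D : PMF (Fin (n + 1))) : Adversary n :=
  fun _ _ => D

/-- The class of all stochastic adversaries. -/
def stochasticAdversaries (n : ℕ) : Set (Adversary n) :=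
  Set.range stochasticAdversary

/-- What the algorithm sees of the past rounds: each query `q` with the feedback `1(x ≤ q)`. -/
def observed {n : ℕ} (h : List (Fin (n + 1) × Fin n)) : List (Fin n × Bool) :=
  h.map fun r => (r.2, decide (r.1 ≤ r.2.castSucc))

/-- The law of the first `t` rounds (sample, query), most recent first, in the game with horizon
`T`. In each round, given the past, sample and query are drawn independently. -/
def play {n : ℕ} (A : CDFAlgorithm n) (B : Adversary n) (T : ℕ) :
    ℕ → PMF (List (Fin (n + 1) × Fin n))
  | 0 => PMF.pure []
  | t + 1 =>
    (play A B T t).bind fun h =>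
      (B T h).bind fun x =>
        (A.query T (observed h)).bind fun q =>
          PMF.pure ((x, q) :: h)

/-- The empirical CDF `F_t(i) = (1 / t) ∑ 1(x_τ ≤ i)`, `i ∈ [n]`, of the samples in `t` rounds. -/
def empiricalCDF {n : ℕ} (h : List (Fin (n + 1) × Fin n)) (i : Fin n) : ℝ :=
  (h.countP fun r => decide (r.1 ≤ i.castSucc) : ℝ) / (h.length : ℝ)

/-- The Kolmogorov–Smirnov distance `sup_{i ∈ [n]} |F i - G i|`. -/
def ksDist {n : ℕ} (F G : Fin n → ℝ) : ℝ :=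
  ⨆ i : Fin n, |F i - G i|

/-- The probability that the estimation error at time `T`, in the game with horizon `T`, is at
most `ε`. -/
def successProb {n : ℕ} (A : CDFAlgorithm n) (B : Adversary n) (T : ℕ) (ε : ℝ) : ℝ≥0∞ :=
  ∑' h : List (Fin (n + 1) × Fin n),
    play A B T T h *
      (A.estimate T (observed h) : Measure (Fin n → unitInterval))
        {G | ksDist (fun i => (G i : ℝ)) (empiricalCDF h) ≤ ε}

/-- The fixed-horizon query complexity of `A` against a class of adversaries at accuracy `ε`: the
least `T₀` such that for all `T > T₀` and all adversaries of the class the error at time `T` is at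
most `ε` with probability at least `3 / 4` (and `⊤` if there is no such `T₀`). -/
def queryComplexity {n : ℕ} (A : CDFAlgorithm n) (𝔅 : Set (Adversary n)) (ε : ℝ) : ℕ∞ :=
  ⨅ (T₀ : ℕ) (_ : ∀ T : ℕ, T₀ < T → ∀ B ∈ 𝔅, 3 / 4 ≤ successProb A B T ε), (T₀ : ℕ∞)

end ComparisonFeedback

end

namespace ComparisonFeedback

noncomputable section

/-! Two hard instances are combined, one for large `n` and one for bounded `n`. For large `n`, take
`m ≈ n / 8` points and let the CDF at each of them be shifted by `±δ`, `δ = 2ε`, according to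
independent fair bits; the hypothesis `ε ≤ 1 / (n + 1)` leaves room for this inside `[1/4, 3/4]`. An
accurate estimate of the empirical CDF is, by Chebyshev, accurate for the true CDF, so it decodes
all `m` bits at once. A query at `i` informs only about bit `i`, so the posterior stays a product.
Measure knowledge of a bit with posterior `p` by the potential `-log (4 p (1 - p))`. One query
raises the expected total potential by at most `64 δ²`, however much is already known
(`sum_bern_mul_logPot_le`). If the total is below `(m / 2) log m`, then by convexity the bits
jointly keep enough uncertainty that all are right with probability at most `exp (-√m / 4)`
(`half_pow_mul_prod_lik_le`, `card_mul_exp_le_sum`). Markov's inequality for the potential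
(`average_decoding_le`) then forces `T` to be of order `m log m / δ²`. For bounded `n ≥ 2` a bound
of order `1 / ε²` is enough. It comes from the sampling noise of the empirical CDF: with three equal
atoms each query fails to identify the sample with probability `2/3`, and each such failure leaves a
fair coin in one of two coordinates of the empirical CDF. Binomial anticoncentration does the rest
(`exists_successProb_lt_of_small`). -/

/-! ### Path sums: the law of the game as iterated finite sums over the reals. -/

/-- The sum of `f` over all paths of length `t`, weighted by the product of the step weights. -/
def pathSum {α : Type*} [Fintype α] (w : List α → α → ℝ) : ℕ → (List α → ℝ) → ℝ
  | 0, f => f []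
  | t + 1, f => pathSum w t fun h => ∑ a, w h a * f (a :: h)

lemma pathSum_sum_mul {α ι : Type*} [Fintype α] (w : List α → α → ℝ) (s : Finset ι) (c : ι → ℝ)
    (t : ℕ) (f : ι → List α → ℝ) :
    pathSum w t (fun h => ∑ i ∈ s, c i * f i h) = ∑ i ∈ s, c i * pathSum w t (f i) := by
  induction t generalizing f with
  | zero => rfl
  | succ t ih =>
    simp only [pathSum]
    rw [← ih]
    congr 1
    funext h
    simp only [Finset.mul_sum]
    rw [Finset.sum_comm]
    refine Finset.sum_congr rfl fun i _ => Finset.sum_congr rfl fun a _ => by ring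

lemma pathSum_const_mul {α : Type*} [Fintype α] (w : List α → α → ℝ) (c : ℝ) (t : ℕ)
    (f : List α → ℝ) : pathSum w t (fun h => c * f h) = c * pathSum w t f := by
  simpa using pathSum_sum_mul w (Finset.univ : Finset Unit) (fun _ => c) t (fun _ => f)

lemma pathSum_add {α : Type*} [Fintype α] (w : List α → α → ℝ) (t : ℕ)
    (f g : List α → ℝ) :
    pathSum w t (fun h => f h + g h) = pathSum w t f + pathSum w t g := by
  simpa using pathSum_sum_mul w (Finset.univ : Finset Bool) (fun _ => 1) t
    (fun b => if b then f else g)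

lemma pathSum_mono {α : Type*} [Fintype α] {w : List α → α → ℝ} (hw : ∀ h a, 0 ≤ w h a) (t : ℕ)
    {f g : List α → ℝ} (hfg : ∀ h, h.length = t → f h ≤ g h) :
    pathSum w t f ≤ pathSum w t g := by
  induction t generalizing f g with
  | zero => exact hfg [] rfl
  | succ t ih =>
    refine ih fun h hh => Finset.sum_le_sum fun a _ => ?_
    exact mul_le_mul_of_nonneg_left (hfg _ (by simp [hh])) (hw h a)

/-- The step weights of the game against i.i.d. samples from `D`. -/
def playWeight {n : ℕ} (A : CDFAlgorithm n) (D : PMF (Fin (n + 1))) (T : ℕ)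
    (h : List (Fin (n + 1) × Fin n)) (a : Fin (n + 1) × Fin n) : ℝ :=
  (D a.1).toReal * (A.query T (observed h) a.2).toReal

/-- The query part of the step weights, on the observed history. -/
def queryWeight {n : ℕ} (A : CDFAlgorithm n) (T : ℕ)
    (o : List (Fin n × Bool)) (a : Fin n × Bool) : ℝ :=
  (A.query T o a.1).toReal

lemma playWeight_nonneg {n : ℕ} (A : CDFAlgorithm n) (D : PMF (Fin (n + 1))) (T : ℕ)
    (h : List (Fin (n + 1) × Fin n)) (a : Fin (n + 1) × Fin n) : 0 ≤ playWeight A D T h a := by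
  unfold playWeight; positivity

lemma queryWeight_nonneg {n : ℕ} (A : CDFAlgorithm n) (T : ℕ)
    (o : List (Fin n × Bool)) (a : Fin n × Bool) : 0 ≤ queryWeight A T o a :=
  ENNReal.toReal_nonneg

lemma sum_toReal_pmf {α : Type*} [Fintype α] (p : PMF α) : ∑ a, (p a).toReal = 1 := by
  rw [← ENNReal.toReal_sum fun a _ => p.apply_ne_top a, ← tsum_fintype (L := .unconditional _),
    p.tsum_coe]
  rfl

lemma tsum_bind_mul {α β : Type*} (p : PMF α) (k : α → PMF β) (g : β → ℝ≥0∞) :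
    ∑' b, p.bind k b * g b = ∑' a, p a * ∑' b, k a b * g b := by
  simp only [PMF.bind_apply, ← ENNReal.tsum_mul_right, ← ENNReal.tsum_mul_left]
  rw [ENNReal.tsum_comm]
  simp only [mul_assoc]

lemma tsum_pure_mul {α : Type*} (a : α) (g : α → ℝ≥0∞) : ∑' b, PMF.pure a b * g b = g a := by
  rw [tsum_eq_single a]
  · simp
  · intro b hb
    simp [PMF.pure_apply, hb]

/-- Bridges the `ℝ≥0∞`-valued law of the game to finite real sums; everything after `successProb_le`
is real arithmetic. -/
lemma tsum_play_mul {n : ℕ} (A : CDFAlgorithm n) (D : PMF (Fin (n + 1))) (T t : ℕ)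
    (f : List (Fin (n + 1) × Fin n) → ℝ) (hf : ∀ h, 0 ≤ f h) :
    ∑' h, play A (stochasticAdversary D) T t h * ENNReal.ofReal (f h) =
      ENNReal.ofReal (pathSum (playWeight A D T) t f) := by
  induction t generalizing f with
  | zero => exact tsum_pure_mul _ _
  | succ t ih =>
    simp only [play, pathSum]
    rw [tsum_bind_mul, ← ih _ fun h => Finset.sum_nonneg fun a _ =>
      mul_nonneg (playWeight_nonneg A D T h a) (hf _)]
    congr 1
    funext h
    congr 1
    rw [tsum_bind_mul, tsum_fintype, ENNReal.ofReal_sum_of_nonneg fun a _ =>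
      mul_nonneg (playWeight_nonneg A D T h a) (hf _), Fintype.sum_prod_type]
    refine Finset.sum_congr rfl fun x _ => ?_
    rw [tsum_bind_mul, tsum_fintype, Finset.mul_sum]
    refine Finset.sum_congr rfl fun q _ => ?_
    rw [tsum_pure_mul, playWeight, ENNReal.ofReal_mul (by positivity),
      ENNReal.ofReal_mul (by positivity), ENNReal.ofReal_toReal (PMF.apply_ne_top _ _),
      ENNReal.ofReal_toReal (PMF.apply_ne_top _ _), mul_assoc]
    rfl

lemma successProb_le {n : ℕ} (A : CDFAlgorithm n) (D : PMF (Fin (n + 1))) (T : ℕ) (ε : ℝ)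
    (f : List (Fin (n + 1) × Fin n) → ℝ)
    (hf : ∀ h, h.length = T → (A.estimate T (observed h) : Measure (Fin n → unitInterval)).real
        {G | ksDist (fun i => (G i : ℝ)) (empiricalCDF h) ≤ ε} ≤ f h) :
    successProb A (stochasticAdversary D) T ε ≤
      ENNReal.ofReal (pathSum (playWeight A D T) T f) := by
  have h1 := tsum_play_mul A D T T
    (fun h => (A.estimate T (observed h) : Measure (Fin n → unitInterval)).real
        {G | ksDist (fun i => (G i : ℝ)) (empiricalCDF h) ≤ ε}) (fun h => measureReal_nonneg)
  simp only [measureReal_def, ENNReal.ofReal_toReal (measure_ne_top _ _)] at h1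
  rw [successProb, h1]
  exact ENNReal.ofReal_le_ofReal (pathSum_mono (playWeight_nonneg A D T) T hf)

lemma abs_sub_le_of_ksDist_le {n : ℕ} {F G : Fin n → ℝ} {ε : ℝ} (h : ksDist F G ≤ ε)
    (i : Fin n) : |F i - G i| ≤ ε :=
  (le_ciSup (f := fun i => |F i - G i|) (Set.finite_range _).bddAbove i).trans h

/-- A single failing distribution at horizon `T` rules out every threshold below `T`. -/
lemma le_queryComplexity {n : ℕ} (A : CDFAlgorithm n) (T : ℕ) (ε : ℝ) (D : PMF (Fin (n + 1)))
    (h : successProb A (stochasticAdversary D) T ε < 3 / 4) :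
    (T : ℕ∞) ≤ queryComplexity A (stochasticAdversaries n) ε := by
  refine le_iInf fun T₀ => le_iInf fun hT => ?_
  by_contra hlt
  push Not at hlt
  exact absurd (hT T (by exact_mod_cast hlt) _ ⟨D, rfl⟩) (not_le.mpr h)

/-! ### Splitting the law into the algorithm's choices and the likelihood of the feedback. -/

/-- The sum of `f` over the histories compatible with the observations `o`, weighted by the
probabilities of their samples. -/
def fiberSum {n : ℕ} (D : PMF (Fin (n + 1))) :
    List (Fin n × Bool) → (List (Fin (n + 1) × Fin n) → ℝ) → ℝ
  | [], f => f []
  | (q, y) :: o, f => fiberSum D o fun h =>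
      ∑ x, (if decide (x ≤ q.castSucc) = y then (D x).toReal else 0) * f ((x, q) :: h)

lemma fiberSum_sum_mul {n : ℕ} {ι : Type*} (D : PMF (Fin (n + 1))) (o : List (Fin n × Bool))
    (s : Finset ι) (c : ι → ℝ) (f : ι → List (Fin (n + 1) × Fin n) → ℝ) :
    fiberSum D o (fun h => ∑ i ∈ s, c i * f i h) = ∑ i ∈ s, c i * fiberSum D o (f i) := by
  induction o generalizing f with
  | nil => rfl
  | cons a o ih =>
    obtain ⟨q, y⟩ := a
    simp only [fiberSum]
    rw [← ih]
    congr 1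
    funext h
    simp only [Finset.mul_sum]
    rw [Finset.sum_comm]
    refine Finset.sum_congr rfl fun i _ => Finset.sum_congr rfl fun a _ => by ring

lemma fiberSum_const_mul {n : ℕ} (D : PMF (Fin (n + 1))) (o : List (Fin n × Bool)) (c : ℝ)
    (f : List (Fin (n + 1) × Fin n) → ℝ) :
    fiberSum D o (fun h => c * f h) = c * fiberSum D o f := by
  simpa using fiberSum_sum_mul D o (Finset.univ : Finset Unit) (fun _ => c) (fun _ => f)

lemma fiberSum_mono {n : ℕ} (D : PMF (Fin (n + 1))) (o : List (Fin n × Bool))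
    {f g : List (Fin (n + 1) × Fin n) → ℝ} (hfg : ∀ h, observed h = o → f h ≤ g h) :
    fiberSum D o f ≤ fiberSum D o g := by
  induction o generalizing f g with
  | nil => exact hfg [] rfl
  | cons a o ih =>
    obtain ⟨q, y⟩ := a
    refine ih fun h hh => Finset.sum_le_sum fun x _ => ?_
    split_ifs with hx
    · refine mul_le_mul_of_nonneg_left (hfg _ ?_) (by positivity)
      rw [observed, List.map_cons, ← observed, hh, hx]
    · simp

lemma fiberSum_one_nonneg {n : ℕ} (D : PMF (Fin (n + 1))) (o : List (Fin n × Bool)) :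
    0 ≤ fiberSum D o fun _ => 1 := by
  have h := fiberSum_mono D o (f := fun _ => 0) (g := fun _ => 1) fun _ _ => zero_le_one
  have h0 := fiberSum_const_mul D o 0 fun _ => 1
  simp only [zero_mul] at h0
  linarith

lemma fiberSum_congr {n : ℕ} (D : PMF (Fin (n + 1))) (o : List (Fin n × Bool))
    {f g : List (Fin (n + 1) × Fin n) → ℝ} (hfg : ∀ h, observed h = o → f h = g h) :
    fiberSum D o f = fiberSum D o g :=
  le_antisymm (fiberSum_mono D o fun h hh => (hfg h hh).le)
    (fiberSum_mono D o fun h hh => (hfg h hh).ge)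

/-- The query probabilities depend on the history only through the observations, so they factor out
of the sum over each fiber. The outer weights omit the feedback probabilities and do not depend on
`D`, which allows different `D` to be compared observation by observation. -/
lemma pathSum_play_eq {n : ℕ} (A : CDFAlgorithm n) (D : PMF (Fin (n + 1))) (T t : ℕ)
    (f : List (Fin (n + 1) × Fin n) → ℝ) :
    pathSum (playWeight A D T) t f = pathSum (queryWeight A T) t fun o => fiberSum D o f := by
  induction t generalizing f with
  | zero => rfl
  | succ t ih =>
    simp only [pathSum]
    rw [ih]
    congr 1
    funext o
    simp only [fiberSum]
    rw [← fiberSum_sum_mul]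
    refine fiberSum_congr D o fun h hh => ?_
    simp only [playWeight, queryWeight, hh, Fintype.sum_prod_type, ← Finset.mul_sum,
      Fintype.sum_bool]
    rw [Finset.sum_comm]
    refine Finset.sum_congr rfl fun q _ => ?_
    rw [← Finset.sum_add_distrib, Finset.mul_sum]
    refine Finset.sum_congr rfl fun x _ => ?_
    by_cases hx : x ≤ q.castSucc <;> simp [hx] <;> ring

/-! ### CDFs and the product form of the likelihood. -/

/-- The cumulative distribution function of `D` at the points of `[n]`. -/
def cdf {n : ℕ} (D : PMF (Fin (n + 1))) (q : Fin n) : ℝ :=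
  ∑ x, if x ≤ q.castSucc then (D x).toReal else 0

/-- The probability mass function of a Bernoulli variable of mean `p`. -/
def bern (p : ℝ) (y : Bool) : ℝ := if y then p else 1 - p

lemma exists_pmf_cdf (n : ℕ) (F : ℕ → ℝ) (hF : Monotone F) (h0 : 0 ≤ F 0) (h1 : ∀ k, F k ≤ 1) :
    ∃ D : PMF (Fin (n + 1)), ∀ q : Fin n, cdf D q = F q := by
  -- `H` is `F` moved by one place, with `0` prepended and the value at `n + 1` forced to be `1`;
  -- the masses are its increments, and values of `F` from `n` on play no role.
  let H : ℕ → ℝ := fun k => if k = 0 then 0 else if k = n + 1 then 1 else F (k - 1)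
  have hH : ∀ k, k ≤ n → H k ≤ H (k + 1) := by
    intro k hk
    simp only [H]
    rcases Nat.eq_zero_or_pos k with rfl | hk0
    · split_ifs <;> first | exact le_rfl | exact zero_le_one | exact h0 | omega
    · rw [if_neg hk0.ne', if_neg (by omega), if_neg (by omega)]
      split_ifs with h
      · exact h1 _
      · exact hF (by omega)
  have hpos : ∀ x : Fin (n + 1), 0 ≤ H (x + 1) - H x :=
    fun x => sub_nonneg.mpr (hH x (by omega))
  refine ⟨PMF.ofFintype (fun x => ENNReal.ofReal (H (x + 1) - H x)) ?_, fun q => ?_⟩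
  · rw [← ENNReal.ofReal_sum_of_nonneg fun x _ => hpos x,
      Fin.sum_univ_eq_sum_range (fun k => H (k + 1) - H k), Finset.sum_range_sub]
    simp [H]
  · simp only [cdf, PMF.ofFintype_apply, ENNReal.toReal_ofReal (hpos _), Fin.le_def,
      Fin.val_castSucc]
    rw [Fin.sum_univ_eq_sum_range (fun k => if k ≤ (q : ℕ) then H (k + 1) - H k else 0),
      ← Finset.sum_filter]
    have : (Finset.range (n + 1)).filter (fun k => k ≤ (q : ℕ)) = Finset.range (q + 1) := by
      ext k; simp; omega
    rw [this, Finset.sum_range_sub]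
    have hq := q.2
    simp only [H, if_true, Nat.add_sub_cancel, Nat.succ_ne_zero, if_false, sub_zero]
    rw [if_neg (by omega)]

lemma sum_bern_cdf {n : ℕ} (D : PMF (Fin (n + 1))) (q : Fin n) (y : Bool) :
    ∑ x, (if decide (x ≤ q.castSucc) = y then (D x).toReal else 0) = bern (cdf D q) y := by
  cases y
  · rw [bern, if_neg (by simp), cdf, ← sum_toReal_pmf D, ← Finset.sum_sub_distrib]
    refine Finset.sum_congr rfl fun x _ => ?_
    by_cases hx : x ≤ q.castSucc <;> simp [hx]
  · simp [bern, cdf]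

lemma fiberSum_one {n : ℕ} (D : PMF (Fin (n + 1))) (q : Fin n) (y : Bool)
    (o : List (Fin n × Bool)) :
    fiberSum D ((q, y) :: o) (fun _ => 1) = bern (cdf D q) y * fiberSum D o fun _ => 1 := by
  simp only [fiberSum, mul_one, sum_bern_cdf]
  simpa using fiberSum_const_mul D o (bern (cdf D q) y) fun _ => 1

/-- The likelihood, under success probability `p`, of the feedback to the query `i`. -/
def lik {n : ℕ} (i : Fin n) (p : ℝ) : List (Fin n × Bool) → ℝ
  | [] => 1
  | (q, y) :: o => (if q = i then bern p y else 1) * lik i p o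

/-- Feedback to the query `i` is Bernoulli with mean `cdf D i`, so the likelihood splits over
coordinates. This is what makes the bits independent a posteriori. -/
lemma fiberSum_eq_prod_lik {n : ℕ} (D : PMF (Fin (n + 1))) (o : List (Fin n × Bool)) :
    fiberSum D o (fun _ => 1) = ∏ i, lik i (cdf D i) o := by
  induction o with
  | nil => simp [fiberSum, lik]
  | cons a o ih =>
    obtain ⟨q, y⟩ := a
    rw [fiberSum_one, ih]
    simp only [lik, Finset.prod_mul_distrib]
    congr 1
    simp

lemma bern_pos {p : ℝ} (h0 : 0 < p) (h1 : p < 1) (y : Bool) : 0 < bern p y := by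
  cases y <;> simp [bern, h0, h1]

lemma lik_pos {n : ℕ} (i : Fin n) {p : ℝ} (h0 : 0 < p) (h1 : p < 1) (o : List (Fin n × Bool)) :
    0 < lik i p o := by
  induction o with
  | nil => simp [lik]
  | cons a o ih =>
    obtain ⟨q, y⟩ := a
    rw [lik]
    split_ifs
    · exact mul_pos (bern_pos h0 h1 y) ih
    · simpa using ih

/-! ### The potential of a posterior and its growth under queries. -/

/-- The potential `-log (4 p (1 - p))` of the posterior `p = l₁ / (l₀ + l₁)`. -/
def logPot (l₀ l₁ : ℝ) : ℝ := 2 * Real.log ((l₀ + l₁) / 2) - Real.log l₀ - Real.log l₁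

lemma exp_neg_logPot {l₀ l₁ : ℝ} (h₀ : 0 < l₀) (h₁ : 0 < l₁) :
    Real.exp (-logPot l₀ l₁) = l₀ * l₁ / ((l₀ + l₁) / 2) ^ 2 := by
  have : -logPot l₀ l₁ = Real.log (l₀ * l₁ / ((l₀ + l₁) / 2) ^ 2) := by
    rw [Real.log_div (by positivity) (by positivity), Real.log_mul h₀.ne' h₁.ne', Real.log_pow]
    simp only [logPot]; push_cast; ring
  rw [this, Real.exp_log (by positivity)]

lemma logPot_nonneg {l₀ l₁ : ℝ} (h₀ : 0 < l₀) (h₁ : 0 < l₁) : 0 ≤ logPot l₀ l₁ := by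
  have h := exp_neg_logPot h₀ h₁
  have : Real.exp (-logPot l₀ l₁) ≤ 1 := by
    rw [h, div_le_one (by positivity)]
    nlinarith [sq_nonneg (l₀ - l₁)]
  linarith [Real.exp_le_one_iff.mp this]

/-- With `p` the posterior of the bit value `b` this reads `p ≤ exp (-p (1 - p))`, which follows
from `p ≤ 1 - p (1 - p)`, that is, `(1 - p)² ≥ 0`. -/
lemma half_le_mean_mul_exp {l₀ l₁ : ℝ} (h₀ : 0 < l₀) (h₁ : 0 < l₁) (b : Bool) :
    1 / 2 * (if b then l₁ else l₀) ≤
      (l₀ + l₁) / 2 * Real.exp (-(1 / 4 * Real.exp (-logPot l₀ l₁))) := by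
  have key : ∀ a c : ℝ, 0 < a → 0 < c →
      1 / 2 * a ≤ (a + c) / 2 * (1 - 1 / 4 * (a * c / ((a + c) / 2) ^ 2)) := by
    intro a c ha hc
    have : (a + c) / 2 * (1 - 1 / 4 * (a * c / ((a + c) / 2) ^ 2)) - 1 / 2 * a =
        c ^ 2 / (2 * (a + c)) := by
      field_simp; ring
    have h2 : 0 ≤ c ^ 2 / (2 * (a + c)) := by positivity
    linarith
  have he := Real.add_one_le_exp (-(1 / 4 * Real.exp (-logPot l₀ l₁)))
  refine le_trans ?_ (mul_le_mul_of_nonneg_left he (by positivity))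
  rw [exp_neg_logPot h₀ h₁]
  cases b
  · have := key l₀ l₁ h₀ h₁
    simp only [Bool.false_eq_true, if_false]
    linarith
  · have := key l₁ l₀ h₁ h₀
    simp only [if_true]
    rw [add_comm l₁ l₀, mul_comm l₁ l₀] at this
    linarith

/-- Feedback `y` of predictive probability `w_y` changes the potential by `log (w_y / p₀_y) + log
(w_y / p₁_y)`. By `log x ≤ x - 1` each mean is at most a chi-square divergence, of order `δ²`
whatever the posterior is. -/
lemma sum_bern_mul_logPot_le {l₀ l₁ p₀ p₁ δ : ℝ} (h₀ : 0 < l₀) (h₁ : 0 < l₁)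
    (hp₀ : 1 / 4 ≤ p₀) (hp₀' : p₀ ≤ 3 / 4) (hp₁ : 1 / 4 ≤ p₁) (hp₁' : p₁ ≤ 3 / 4)
    (hδ : |p₁ - p₀| ≤ 2 * δ) :
    ∑ y, (bern p₀ y * l₀ + bern p₁ y * l₁) / 2 * logPot (bern p₀ y * l₀) (bern p₁ y * l₁) ≤
      (l₀ + l₁) / 2 * (logPot l₀ l₁ + 64 * δ ^ 2) := by
  have hb₀ := bern_pos (p := p₀) (by linarith) (by linarith)
  have hb₁ := bern_pos (p := p₁) (by linarith) (by linarith)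
  -- The predictive probability of a positive answer: the posterior mean of `p₀` and `p₁`, hence
  -- between them.
  obtain ⟨w, hw⟩ : ∃ w, w = (p₀ * l₀ + p₁ * l₁) / (l₀ + l₁) := ⟨_, rfl⟩
  have hs : 0 < l₀ + l₁ := by positivity
  have hwl : w * (l₀ + l₁) = p₀ * l₀ + p₁ * l₁ := by rw [hw]; field_simp
  have hmean : ∀ y, (bern p₀ y * l₀ + bern p₁ y * l₁) / 2 = bern w y * ((l₀ + l₁) / 2) := by
    intro y
    cases y <;> simp only [bern, if_true, Bool.false_eq_true, if_false] <;> linarith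
  have hbw : ∀ y, 0 < bern w y := by
    intro y
    have : 0 < bern w y * ((l₀ + l₁) / 2) := by
      rw [← hmean]; have := hb₀ y; have := hb₁ y; positivity
    exact (pos_iff_pos_of_mul_pos this).mpr (by positivity)
  have hpot : ∀ y, logPot (bern p₀ y * l₀) (bern p₁ y * l₁) ≤
      logPot l₀ l₁ + ((bern w y / bern p₀ y - 1) + (bern w y / bern p₁ y - 1)) := by
    intro y
    rw [logPot, hmean, Real.log_mul (hbw y).ne' (by positivity),
      Real.log_mul (hb₀ y).ne' h₀.ne', Real.log_mul (hb₁ y).ne' h₁.ne', logPot]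
    have e₀ := Real.log_le_sub_one_of_pos (div_pos (hbw y) (hb₀ y))
    have e₁ := Real.log_le_sub_one_of_pos (div_pos (hbw y) (hb₁ y))
    rw [Real.log_div (hbw y).ne' (hb₀ y).ne'] at e₀
    rw [Real.log_div (hbw y).ne' (hb₁ y).ne'] at e₁
    linarith
  -- `p (1 - p) ≥ 3/16` on `[1/4, 3/4]`, and `4 / (3/16) = 64/3 ≤ 32`.
  have hchi : ∀ p : ℝ, 1 / 4 ≤ p → p ≤ 3 / 4 → (w - p) ^ 2 ≤ 4 * δ ^ 2 →
      ∑ y, bern w y * (bern w y / bern p y - 1) ≤ 32 * δ ^ 2 := by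
    intro p hp hp' hwp
    have hp1 : 0 < p := by linarith
    have hp2 : 0 < 1 - p := by linarith
    have : ∑ y, bern w y * (bern w y / bern p y - 1) = (w - p) ^ 2 / (p * (1 - p)) := by
      simp only [Fintype.sum_bool, bern, if_true, Bool.false_eq_true, if_false]
      field_simp
      ring
    rw [this, div_le_iff₀ (by positivity)]
    have : 3 / 16 ≤ p * (1 - p) := by nlinarith
    nlinarith [sq_nonneg δ]
  have hsq : (p₁ - p₀) ^ 2 ≤ 4 * δ ^ 2 := by
    have := sq_le_sq' (by linarith [abs_nonneg (p₁ - p₀), (abs_le.mp hδ).1]) (abs_le.mp hδ).2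
    linarith
  have hw₀ : (w - p₀) ^ 2 ≤ 4 * δ ^ 2 := by
    have : w - p₀ = (p₁ - p₀) * (l₁ / (l₀ + l₁)) := by rw [hw]; field_simp; ring
    rw [this, mul_pow]
    refine le_trans (mul_le_of_le_one_right (sq_nonneg _) ?_) hsq
    refine pow_le_one₀ (by positivity) ?_
    rw [div_le_one hs]; linarith
  have hw₁ : (w - p₁) ^ 2 ≤ 4 * δ ^ 2 := by
    have : w - p₁ = (p₁ - p₀) * (-(l₀ / (l₀ + l₁))) := by rw [hw]; field_simp; ring
    rw [this, mul_pow, neg_sq]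
    refine le_trans (mul_le_of_le_one_right (sq_nonneg _) ?_) hsq
    refine pow_le_one₀ (by positivity) ?_
    rw [div_le_one hs]; linarith
  have c₀ := hchi p₀ hp₀ hp₀' hw₀
  have c₁ := hchi p₁ hp₁ hp₁' hw₁
  have hsum : ∑ y, bern w y = 1 := by simp [bern]
  calc _ ≤ ∑ y, bern w y * ((l₀ + l₁) / 2) *
        (logPot l₀ l₁ + ((bern w y / bern p₀ y - 1) + (bern w y / bern p₁ y - 1))) := by
        refine Finset.sum_le_sum fun y _ => ?_
        rw [hmean]
        exact mul_le_mul_of_nonneg_left (hpot y) (mul_nonneg (hbw y).le (by positivity))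
    _ = (l₀ + l₁) / 2 * ((∑ y, bern w y) * logPot l₀ l₁ +
          (∑ y, bern w y * (bern w y / bern p₀ y - 1) +
            ∑ y, bern w y * (bern w y / bern p₁ y - 1))) := by
        rw [Finset.sum_mul, ← Finset.sum_add_distrib, ← Finset.sum_add_distrib, Finset.mul_sum]
        refine Finset.sum_congr rfl fun y _ => by ring
    _ ≤ _ := by
        rw [hsum]
        refine mul_le_mul_of_nonneg_left (by linarith) (by positivity)

/-- The Bayesian mixture of the likelihoods over independent fair bits. -/
def mixture {n : ℕ} (p₀ p₁ : Fin n → ℝ) (o : List (Fin n × Bool)) : ℝ :=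
  ∏ i, (lik i (p₀ i) o + lik i (p₁ i) o) / 2

/-- The total potential of the posteriors. -/
def potential {n : ℕ} (p₀ p₁ : Fin n → ℝ) (o : List (Fin n × Bool)) : ℝ :=
  ∑ i, logPot (lik i (p₀ i) o) (lik i (p₁ i) o)

lemma sum_mixture_mul_potential_le {n : ℕ} {p₀ p₁ : Fin n → ℝ} {δ : ℝ}
    (hp₀ : ∀ i, 1 / 4 ≤ p₀ i ∧ p₀ i ≤ 3 / 4) (hp₁ : ∀ i, 1 / 4 ≤ p₁ i ∧ p₁ i ≤ 3 / 4)
    (hδ : ∀ i, |p₁ i - p₀ i| ≤ 2 * δ) (c : ℝ) (q : Fin n) (o : List (Fin n × Bool)) :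
    ∑ y, mixture p₀ p₁ ((q, y) :: o) * (potential p₀ p₁ ((q, y) :: o) + c) ≤
      mixture p₀ p₁ o * (potential p₀ p₁ o + (c + 64 * δ ^ 2)) := by
  have hl₀ : ∀ i, 0 < lik i (p₀ i) o := fun i =>
    lik_pos i (by linarith [(hp₀ i).1]) (by linarith [(hp₀ i).2]) o
  have hl₁ : ∀ i, 0 < lik i (p₁ i) o := fun i =>
    lik_pos i (by linarith [(hp₁ i).1]) (by linarith [(hp₁ i).2]) o
  have hmem := Finset.mem_univ q
  obtain ⟨P, hP⟩ : ∃ P, P = ∏ i ∈ Finset.univ.erase q,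
    (lik i (p₀ i) o + lik i (p₁ i) o) / 2 := ⟨_, rfl⟩
  obtain ⟨S, hS⟩ : ∃ S, S = ∑ i ∈ Finset.univ.erase q,
    logPot (lik i (p₀ i) o) (lik i (p₁ i) o) := ⟨_, rfl⟩
  have hP0 : 0 ≤ P := by
    rw [hP]
    exact Finset.prod_nonneg fun i _ => by have := hl₀ i; have := hl₁ i; positivity
  have hM : mixture p₀ p₁ o = (lik q (p₀ q) o + lik q (p₁ q) o) / 2 * P := by
    rw [mixture, ← Finset.mul_prod_erase _ _ hmem, hP]
  have hΦ : potential p₀ p₁ o = logPot (lik q (p₀ q) o) (lik q (p₁ q) o) + S := by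
    rw [potential, ← Finset.add_sum_erase _ _ hmem, hS]
  have hM' : ∀ y, mixture p₀ p₁ ((q, y) :: o) =
      (bern (p₀ q) y * lik q (p₀ q) o + bern (p₁ q) y * lik q (p₁ q) o) / 2 * P := by
    intro y
    rw [mixture, ← Finset.mul_prod_erase _ _ hmem, hP]
    simp only [lik, if_true]
    congr 1
    refine Finset.prod_congr rfl fun i hi => ?_
    simp [(Finset.ne_of_mem_erase hi).symm]
  have hΦ' : ∀ y, potential p₀ p₁ ((q, y) :: o) =
      logPot (bern (p₀ q) y * lik q (p₀ q) o) (bern (p₁ q) y * lik q (p₁ q) o) + S := by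
    intro y
    rw [potential, ← Finset.add_sum_erase _ _ hmem, hS]
    simp only [lik, if_true]
    congr 1
    refine Finset.sum_congr rfl fun i hi => ?_
    simp [(Finset.ne_of_mem_erase hi).symm]
  have key := sum_bern_mul_logPot_le (hl₀ q) (hl₁ q) (hp₀ q).1 (hp₀ q).2 (hp₁ q).1 (hp₁ q).2 (hδ q)
  have hone : ∑ y, (bern (p₀ q) y * lik q (p₀ q) o + bern (p₁ q) y * lik q (p₁ q) o) / 2 =
      (lik q (p₀ q) o + lik q (p₁ q) o) / 2 := by
    simp only [Fintype.sum_bool, bern, if_true, Bool.false_eq_true, if_false]; ring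
  simp only [hM, hΦ, hM', hΦ']
  have := mul_le_mul_of_nonneg_left key hP0
  calc _ = P * (∑ y, (bern (p₀ q) y * lik q (p₀ q) o + bern (p₁ q) y * lik q (p₁ q) o) / 2 *
        logPot (bern (p₀ q) y * lik q (p₀ q) o) (bern (p₁ q) y * lik q (p₁ q) o)) +
        P * (S + c) *
          ∑ y, (bern (p₀ q) y * lik q (p₀ q) o + bern (p₁ q) y * lik q (p₁ q) o) / 2 := by
        rw [Finset.mul_sum, Finset.mul_sum, ← Finset.sum_add_distrib]
        refine Finset.sum_congr rfl fun y _ => by ring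
    _ ≤ _ := by
        rw [hone]
        linarith

/-- The potential starts at `0` and gains at most `64 δ²` per round on average. The free constant
`c` absorbs these gains in the induction, since the last round is summed out first. -/
lemma pathSum_mixture_mul_potential_le {n : ℕ} (A : CDFAlgorithm n) (T t : ℕ)
    {p₀ p₁ : Fin n → ℝ} {δ : ℝ}
    (hp₀ : ∀ i, 1 / 4 ≤ p₀ i ∧ p₀ i ≤ 3 / 4) (hp₁ : ∀ i, 1 / 4 ≤ p₁ i ∧ p₁ i ≤ 3 / 4)
    (hδ : ∀ i, |p₁ i - p₀ i| ≤ 2 * δ) (c : ℝ) :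
    pathSum (queryWeight A T) t (fun o => mixture p₀ p₁ o * (potential p₀ p₁ o + c)) ≤
      c + 64 * δ ^ 2 * t := by
  induction t generalizing c with
  | zero => simp [pathSum, mixture, potential, lik, logPot]
  | succ t ih =>
    refine le_trans (pathSum_mono (queryWeight_nonneg A T) t fun o _ => ?_)
      ((ih (c + 64 * δ ^ 2)).trans (le_of_eq (by push_cast; ring)))
    simp only [Fintype.sum_prod_type, queryWeight, ← Finset.mul_sum]
    calc _ ≤ ∑ q, (A.query T o q).toReal *
          (mixture p₀ p₁ o * (potential p₀ p₁ o + (c + 64 * δ ^ 2))) :=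
          Finset.sum_le_sum fun q _ => mul_le_mul_of_nonneg_left
            (sum_mixture_mul_potential_le hp₀ hp₁ hδ c q o) ENNReal.toReal_nonneg
      _ = _ := by rw [← Finset.sum_mul, sum_toReal_pmf, one_mul]

/-! ### Variance of the empirical CDF. -/

/-- The unnormalised deviation of the empirical CDF at `i` from the CDF of `D`. -/
def deviation {n : ℕ} (D : PMF (Fin (n + 1))) (i : Fin n) (h : List (Fin (n + 1) × Fin n)) : ℝ :=
  (h.countP fun r => decide (r.1 ≤ i.castSucc) : ℝ) - cdf D i * h.length

lemma pathSum_deviation_sq {n : ℕ} (A : CDFAlgorithm n) (D : PMF (Fin (n + 1))) (T : ℕ)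
    (i : Fin n) (t : ℕ) (c : ℝ) :
    pathSum (playWeight A D T) t (fun h => deviation D i h ^ 2 + c) =
      t * (cdf D i * (1 - cdf D i)) + c := by
  induction t generalizing c with
  | zero => simp [pathSum, deviation]
  | succ t ih =>
    rw [pathSum]
    have : (fun h : List (Fin (n + 1) × Fin n) =>
        ∑ a, playWeight A D T h a * (deviation D i (a :: h) ^ 2 + c)) =
        fun h => deviation D i h ^ 2 + (c + cdf D i * (1 - cdf D i)) := by
      funext h
      have hx : ∀ x q, deviation D i ((x, q) :: h) =
          deviation D i h + ((if x ≤ i.castSucc then 1 else 0) - cdf D i) := by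
        intro x q
        simp only [deviation, List.countP_cons, List.length_cons, decide_eq_true_eq]
        push_cast
        ring
      simp only [Fintype.sum_prod_type, playWeight, hx]
      have hq : ∀ x, ∑ q, (D x).toReal * (A.query T (observed h) q).toReal *
          ((deviation D i h + ((if x ≤ i.castSucc then 1 else 0) - cdf D i)) ^ 2 + c) =
          ((deviation D i h - cdf D i) ^ 2 + c) * (D x).toReal +
          (2 * (deviation D i h - cdf D i) + 1) *
            (if x ≤ i.castSucc then (D x).toReal else 0) := by
        intro x
        rw [← Finset.sum_mul, ← Finset.mul_sum, sum_toReal_pmf]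
        split_ifs <;> ring
      simp only [hq, Finset.sum_add_distrib, ← Finset.mul_sum, sum_toReal_pmf]
      rw [← cdf]
      ring
    rw [this, ih]
    push_cast
    ring

/-! ### Decoding all bits at once. -/

/-- The left side is the joint weight of the bit pattern `B` and the observations. Divided by the
mixture it is a product of coordinate posteriors, each controlled by `half_le_mean_mul_exp`;
coordinates outside `J` cancel. -/
lemma half_pow_mul_prod_lik_le {n : ℕ} {p₀ p₁ : Fin n → ℝ} {J B : Finset (Fin n)} (hB : B ⊆ J)
    (hp₀ : ∀ i, 0 < p₀ i ∧ p₀ i < 1) (hp₁ : ∀ i, 0 < p₁ i ∧ p₁ i < 1)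
    (hJ : ∀ i ∉ J, p₀ i = p₁ i) (o : List (Fin n × Bool)) :
    (1 / 2) ^ J.card * ∏ i, lik i (if i ∈ B then p₁ i else p₀ i) o ≤
      mixture p₀ p₁ o *
        Real.exp (-(1 / 4 * ∑ i ∈ J, Real.exp (-logPot (lik i (p₀ i) o) (lik i (p₁ i) o)))) := by
  have hl₀ : ∀ i, 0 < lik i (p₀ i) o := fun i => lik_pos i (hp₀ i).1 (hp₀ i).2 o
  have hl₁ : ∀ i, 0 < lik i (p₁ i) o := fun i => lik_pos i (hp₁ i).1 (hp₁ i).2 o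
  have e1 : ((1 : ℝ) / 2) ^ J.card = ∏ i, if i ∈ J then (1 / 2 : ℝ) else 1 := by
    rw [Finset.prod_ite_mem, Finset.univ_inter, Finset.prod_const]
  have e2 : Real.exp (-(1 / 4 * ∑ i ∈ J,
      Real.exp (-logPot (lik i (p₀ i) o) (lik i (p₁ i) o)))) = ∏ i, if i ∈ J then
        Real.exp (-(1 / 4 * Real.exp (-logPot (lik i (p₀ i) o) (lik i (p₁ i) o)))) else 1 := by
    rw [Finset.prod_ite_mem, Finset.univ_inter, ← Real.exp_sum, Finset.mul_sum,
      Finset.sum_neg_distrib]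
  rw [e1, e2, mixture, ← Finset.prod_mul_distrib, ← Finset.prod_mul_distrib]
  refine Finset.prod_le_prod (fun i _ => ?_) fun i _ => ?_
  · have := hl₀ i
    have := hl₁ i
    split_ifs <;> positivity
  · by_cases hi : i ∈ J
    · have := half_le_mean_mul_exp (hl₀ i) (hl₁ i) (decide (i ∈ B))
      by_cases hiB : i ∈ B <;> simpa [hi, hiB] using this
    · have hiB : i ∉ B := fun h => hi (hB h)
      simp [hi, hiB, hJ i hi]

/-- Jensen's inequality for `exp`, proved with the tangent line at `-L / J.card`. -/
lemma card_mul_exp_le_sum {ι : Type*} (J : Finset ι) (hJ : J.Nonempty) (φ : ι → ℝ) {L : ℝ}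
    (hL : ∑ i ∈ J, φ i ≤ L) :
    J.card * Real.exp (-(L / J.card)) ≤ ∑ i ∈ J, Real.exp (-φ i) := by
  have hm : (0 : ℝ) < J.card := by exact_mod_cast hJ.card_pos
  obtain ⟨a, ha⟩ : ∃ a, a = L / J.card := ⟨_, rfl⟩
  have ham : J.card * a = L := by rw [ha]; field_simp
  rw [← ha]
  calc J.card * Real.exp (-a) ≤ Real.exp (-a) * ∑ i ∈ J, (a - φ i + 1) := by
        rw [Finset.sum_add_distrib, Finset.sum_sub_distrib, Finset.sum_const, Finset.sum_const,
          nsmul_eq_mul, nsmul_eq_mul, ham, mul_comm]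
        exact mul_le_mul_of_nonneg_left (by linarith) (Real.exp_pos _).le
    _ = ∑ i ∈ J, Real.exp (-a) * (a - φ i + 1) := Finset.mul_sum ..
    _ ≤ ∑ i ∈ J, Real.exp (-φ i) := Finset.sum_le_sum fun i _ => by
        have := mul_le_mul_of_nonneg_left (Real.add_one_le_exp (a - φ i)) (Real.exp_pos (-a)).le
        rwa [← Real.exp_add, show -a + (a - φ i) = -φ i by ring] at this

/-- Here `g B o` is the probability that the output decodes to `B`. Since the decoding events share
total mass at most `1`, the Bayes success probability is at most the largest posterior: small when
the potential is below `L`, while Markov's inequality bounds the chance that it exceeds `L`. -/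
lemma average_decoding_le {n : ℕ} (A : CDFAlgorithm n) (T : ℕ) {p₀ p₁ : Fin n → ℝ}
    {J : Finset (Fin n)} (hJ0 : J.Nonempty) {δ L : ℝ} (hL : 0 < L)
    (hp₀ : ∀ i, 1 / 4 ≤ p₀ i ∧ p₀ i ≤ 3 / 4) (hp₁ : ∀ i, 1 / 4 ≤ p₁ i ∧ p₁ i ≤ 3 / 4)
    (hδ : ∀ i, |p₁ i - p₀ i| ≤ 2 * δ) (hJ : ∀ i ∉ J, p₀ i = p₁ i)
    (D : Finset (Fin n) → PMF (Fin (n + 1)))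
    (hD : ∀ B i, cdf (D B) i = if i ∈ B then p₁ i else p₀ i)
    (g : Finset (Fin n) → List (Fin n × Bool) → ℝ) (hg : ∀ B o, 0 ≤ g B o)
    (hg1 : ∀ o, ∑ B ∈ J.powerset, g B o ≤ 1) :
    ∑ B ∈ J.powerset, (1 / 2) ^ J.card *
        pathSum (playWeight A (D B) T) T (fun h => g B (observed h)) ≤
      Real.exp (-(1 / 4 * (J.card * Real.exp (-(L / J.card))))) + 64 * δ ^ 2 * T / L := by
  have hp₀' : ∀ i, 0 < p₀ i ∧ p₀ i < 1 := fun i =>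
    ⟨by linarith [(hp₀ i).1], by linarith [(hp₀ i).2]⟩
  have hp₁' : ∀ i, 0 < p₁ i ∧ p₁ i < 1 := fun i =>
    ⟨by linarith [(hp₁ i).1], by linarith [(hp₁ i).2]⟩
  obtain ⟨e, he⟩ : ∃ e, e = Real.exp (-(1 / 4 * (J.card * Real.exp (-(L / J.card))))) := ⟨_, rfl⟩
  have he0 : 0 ≤ e := he ▸ (Real.exp_pos _).le
  have hpath : ∀ B, pathSum (playWeight A (D B) T) T (fun h => g B (observed h)) =
      pathSum (queryWeight A T) T fun o =>
        g B o * ∏ i, lik i (if i ∈ B then p₁ i else p₀ i) o := by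
    intro B
    rw [pathSum_play_eq]
    congr 1
    funext o
    simp only [← hD, ← fiberSum_eq_prod_lik]
    rw [← fiberSum_const_mul]
    exact fiberSum_congr _ _ fun h hh => by rw [hh, mul_one]
  have hpoint : ∀ o, ∑ B ∈ J.powerset, (1 / 2) ^ J.card *
      (g B o * ∏ i, lik i (if i ∈ B then p₁ i else p₀ i) o) ≤
      1 / L * (mixture p₀ p₁ o * (potential p₀ p₁ o + e * L)) := by
    intro o
    have hl₀ : ∀ i, 0 < lik i (p₀ i) o := fun i => lik_pos i (hp₀' i).1 (hp₀' i).2 o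
    have hl₁ : ∀ i, 0 < lik i (p₁ i) o := fun i => lik_pos i (hp₁' i).1 (hp₁' i).2 o
    have hM0 : 0 ≤ mixture p₀ p₁ o :=
      Finset.prod_nonneg fun i _ => by have := hl₀ i; have := hl₁ i; positivity
    obtain ⟨s, hs⟩ : ∃ s, s = Real.exp (-(1 / 4 * ∑ i ∈ J,
      Real.exp (-logPot (lik i (p₀ i) o) (lik i (p₁ i) o)))) := ⟨_, rfl⟩
    have hJΦ : ∑ i ∈ J, logPot (lik i (p₀ i) o) (lik i (p₁ i) o) ≤ potential p₀ p₁ o :=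
      Finset.sum_le_sum_of_subset_of_nonneg (Finset.subset_univ J)
        fun i _ _ => logPot_nonneg (hl₀ i) (hl₁ i)
    have hΦ0 : 0 ≤ potential p₀ p₁ o :=
      Finset.sum_nonneg fun i _ => logPot_nonneg (hl₀ i) (hl₁ i)
    -- Markov's inequality in pointwise form: either `potential / L ≥ 1 ≥ s`, or the potential is
    -- below `L` and Jensen gives `s ≤ e`.
    have hse : s ≤ potential p₀ p₁ o / L + e := by
      rcases le_or_gt L (potential p₀ p₁ o) with h | h
      · have h1 : 1 ≤ potential p₀ p₁ o / L := (one_le_div hL).mpr h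
        have h2 : s ≤ 1 := by
          rw [hs, Real.exp_le_one_iff, neg_nonpos]
          exact mul_nonneg (by norm_num) (Finset.sum_nonneg fun i _ => (Real.exp_pos _).le)
        linarith
      · have h1 : s ≤ e := by
          rw [hs, he, Real.exp_le_exp, neg_le_neg_iff]
          exact mul_le_mul_of_nonneg_left
            (card_mul_exp_le_sum J hJ0 _ (hJΦ.trans h.le)) (by norm_num)
        have h2 : 0 ≤ potential p₀ p₁ o / L := div_nonneg hΦ0 hL.le
        linarith
    calc _ ≤ ∑ B ∈ J.powerset, g B o * (mixture p₀ p₁ o * s) := by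
          refine Finset.sum_le_sum fun B hB => ?_
          have := half_pow_mul_prod_lik_le (Finset.mem_powerset.mp hB) hp₀' hp₁' hJ o
          rw [← hs] at this
          rw [mul_left_comm]
          exact mul_le_mul_of_nonneg_left this (hg B o)
      _ = (∑ B ∈ J.powerset, g B o) * (mixture p₀ p₁ o * s) := by rw [Finset.sum_mul]
      _ ≤ 1 * (mixture p₀ p₁ o * s) := by
          refine mul_le_mul_of_nonneg_right (hg1 o) (mul_nonneg hM0 ?_)
          rw [hs]; exact (Real.exp_pos _).le
      _ ≤ mixture p₀ p₁ o * (potential p₀ p₁ o / L + e) := by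
          rw [one_mul]; exact mul_le_mul_of_nonneg_left hse hM0
      _ = _ := by field_simp
  simp only [hpath]
  rw [← pathSum_sum_mul]
  refine (pathSum_mono (queryWeight_nonneg A T) T fun o _ => hpoint o).trans ?_
  rw [pathSum_const_mul, ← he]
  have := pathSum_mixture_mul_potential_le A T T hp₀ hp₁ hδ (e * L)
  calc _ ≤ 1 / L * (e * L + 64 * δ ^ 2 * T) :=
        mul_le_mul_of_nonneg_left this (by positivity)
    _ = _ := by field_simp

/-! ### The hard family for large `n`. -/

/-- A CDF whose values at the first `m` points are shifted by `δ`, upwards at the points marked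
by `b` and downwards at the others. -/
def shiftedCDF (m : ℕ) (δ : ℝ) (b : ℕ → Bool) (k : ℕ) : ℝ :=
  if k < m then 1 / 4 + (2 * k + 1) * δ + (if b k then δ else -δ) else 3 / 4

lemma shiftedCDF_mem {m : ℕ} {δ : ℝ} (hδ : 0 ≤ δ) (hm : 2 * m * δ ≤ 1 / 2) (b : ℕ → Bool)
    (k : ℕ) : 1 / 4 ≤ shiftedCDF m δ b k ∧ shiftedCDF m δ b k ≤ 3 / 4 := by
  rw [shiftedCDF]
  split_ifs with hk hb
  all_goals try have h1 : (k : ℝ) + 1 ≤ m := by exact_mod_cast hk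
  all_goals try have h2 := mul_le_mul_of_nonneg_right h1 hδ
  all_goals have h3 : 0 ≤ (k : ℝ) * δ := by positivity
  all_goals constructor <;> linarith

lemma shiftedCDF_monotone {m : ℕ} {δ : ℝ} (hδ : 0 ≤ δ) (hm : 2 * m * δ ≤ 1 / 2) (b : ℕ → Bool) :
    Monotone (shiftedCDF m δ b) := by
  refine monotone_nat_of_le_succ fun k => ?_
  by_cases hk : k + 1 < m
  · rw [shiftedCDF, shiftedCDF, if_pos hk, if_pos (by omega)]
    push_cast
    split_ifs <;> linarith
  · have : shiftedCDF m δ b (k + 1) = 3 / 4 := if_neg hk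
    rw [this]
    exact (shiftedCDF_mem hδ hm b k).2

/-- If some deviation at a point of `J` reaches `ε T`, its Chebyshev term is already at least `1`;
otherwise the triangle inequality passes from the empirical to the true CDF at the cost of a second
`ε`. -/
lemma measureReal_ksDist_le {n : ℕ} (μ : Measure (Fin n → unitInterval)) [IsProbabilityMeasure μ]
    (D : PMF (Fin (n + 1))) (J : Finset (Fin n)) {ε : ℝ} (hε : 0 < ε) {T : ℕ} (hT : 0 < T)
    {h : List (Fin (n + 1) × Fin n)} (hh : h.length = T) :
    μ.real {G | ksDist (fun i => (G i : ℝ)) (empiricalCDF h) ≤ ε} ≤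
      μ.real {G | ∀ i ∈ J, |(G i : ℝ) - cdf D i| < 2 * ε} +
        ∑ i ∈ J, 1 / (ε * T) ^ 2 * (deviation D i h ^ 2 + 0) := by
  have hT' : (0 : ℝ) < T := by exact_mod_cast hT
  have hnn : ∀ i ∈ J, 0 ≤ 1 / (ε * T) ^ 2 * (deviation D i h ^ 2 + 0) := fun i _ => by positivity
  by_cases hex : ∃ i ∈ J, ε * T ≤ |deviation D i h|
  · obtain ⟨i, hi, hdev⟩ := hex
    have h1 : 1 ≤ 1 / (ε * T) ^ 2 * (deviation D i h ^ 2 + 0) := by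
      rw [add_zero, one_div, ← div_eq_inv_mul, one_le_div (by positivity), ← sq_abs (deviation D i h)]
      exact pow_le_pow_left₀ (by positivity) hdev 2
    have h2 := Finset.single_le_sum hnn hi
    have h3 : μ.real {G | ksDist (fun i => (G i : ℝ)) (empiricalCDF h) ≤ ε} ≤ 1 :=
      measureReal_le_one
    have h4 : 0 ≤ μ.real {G | ∀ i ∈ J, |(G i : ℝ) - cdf D i| < 2 * ε} := measureReal_nonneg
    linarith
  · push Not at hex
    have hsub : {G : Fin n → unitInterval | ksDist (fun i => (G i : ℝ)) (empiricalCDF h) ≤ ε} ⊆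
        {G | ∀ i ∈ J, |(G i : ℝ) - cdf D i| < 2 * ε} := by
      intro G hG i hi
      have h1 := abs_sub_le_of_ksDist_le hG i
      have h2 : |empiricalCDF h i - cdf D i| < ε := by
        have : empiricalCDF h i - cdf D i = deviation D i h / T := by
          rw [empiricalCDF, deviation, hh]; field_simp
        rw [this, abs_div, abs_of_pos hT', div_lt_iff₀ hT']
        exact hex i hi
      calc |(G i : ℝ) - cdf D i| ≤ |(G i : ℝ) - empiricalCDF h i| + |empiricalCDF h i - cdf D i| :=
            abs_sub_le _ _ _
        _ < 2 * ε := by linarith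
    have := measureReal_mono (μ := μ) hsub
    have := Finset.sum_nonneg hnn
    linarith

/-- The two candidate values are `2 δ` apart, so open windows of radius `δ` make the decoding events
disjoint. -/
lemma sum_measureReal_decode_le_one {n : ℕ} (μ : Measure (Fin n → unitInterval))
    [IsProbabilityMeasure μ] (J : Finset (Fin n)) (δ : ℝ) (p₀ p₁ : Fin n → ℝ)
    (hp : ∀ i ∈ J, p₀ i + 2 * δ = p₁ i) :
    ∑ B ∈ J.powerset,
      μ.real {G | ∀ i ∈ J, |(G i : ℝ) - if i ∈ B then p₁ i else p₀ i| < δ} ≤ 1 := by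
  rw [← measureReal_biUnion_finset]
  · exact measureReal_le_one
  · intro B hB C hC hBC
    rw [Function.onFun, Set.disjoint_left]
    intro G hGB hGC
    apply hBC
    have hB' := Finset.mem_powerset.mp hB
    have hC' := Finset.mem_powerset.mp hC
    ext i
    by_cases hi : i ∈ J
    · have h1 := abs_lt.mp (hGB i hi)
      have h2 := abs_lt.mp (hGC i hi)
      have h3 := hp i hi
      by_cases hiB : i ∈ B <;> by_cases hiC : i ∈ C <;> simp only [hiB, hiC, if_true, if_false] at *
      · linarith [h1.1, h1.2, h2.1, h2.2]
      · linarith [h1.1, h1.2, h2.1, h2.2]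
    · exact ⟨fun h => absurd (hB' h) hi, fun h => absurd (hC' h) hi⟩
  · intro B _
    have : {G : Fin n → unitInterval | ∀ i ∈ J, |(G i : ℝ) - if i ∈ B then p₁ i else p₀ i| < δ} =
        ⋂ i ∈ J, {G | |(G i : ℝ) - if i ∈ B then p₁ i else p₀ i| < δ} := by
      ext G; simp
    rw [this]
    refine Finset.measurableSet_biInter _ fun i _ => ?_
    refine measurableSet_lt ?_ measurable_const
    exact ((measurable_subtype_coe.comp (measurable_pi_apply i)).sub measurable_const).abs

lemma exists_successProb_lt_of_large {n m : ℕ} (A : CDFAlgorithm n) {ε : ℝ} (hε : 0 < ε)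
    (hεn : ε ≤ 1 / ((n : ℝ) + 1)) (hmn : 8 * m ≤ n + 1) (hm : 16384 ≤ Real.log m) {T : ℕ}
    (hT₁ : T * (4096 * ε ^ 2) ≤ m * Real.log m) (hT₂ : m * Real.log m ≤ T * (8192 * ε ^ 2)) :
    ∃ D, successProb A (stochasticAdversary D) T ε < 3 / 4 := by
  have hm0 : 0 < m := by
    rcases Nat.eq_zero_or_pos m with rfl | h
    · norm_num at hm
    · exact h
  have hmR : (0 : ℝ) < m := by exact_mod_cast hm0
  have hlog : 0 < Real.log m := by linarith
  have hT : 0 < T := by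
    rcases Nat.eq_zero_or_pos T with rfl | h
    · have := mul_pos hmR hlog
      norm_num at hT₂
      linarith
    · exact h
  have hTR : (0 : ℝ) < T := by exact_mod_cast hT
  -- Twice `ε`: one `ε` for the estimation error and one for the sampling error.
  obtain ⟨δ, hδ⟩ : ∃ δ, δ = 2 * ε := ⟨_, rfl⟩
  have hδ0 : 0 ≤ δ := by linarith
  have hmδ : 2 * m * δ ≤ 1 / 2 := by
    have h1 : (8 : ℝ) * m ≤ n + 1 := by exact_mod_cast hmn
    have h2 : ε * ((n : ℝ) + 1) ≤ 1 := by rwa [le_div_iff₀ (by positivity)] at hεn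
    have h3 := mul_le_mul_of_nonneg_left h1 hε.le
    rw [hδ]; linarith
  obtain ⟨J, hJ⟩ : ∃ J : Finset (Fin n), J = Finset.univ.filter fun i : Fin n => (i : ℕ) < m :=
    ⟨_, rfl⟩
  have hmemJ : ∀ i, i ∈ J ↔ (i : ℕ) < m := by simp [hJ]
  have hJcard : J.card = m := by
    rw [hJ, Fin.card_filter_val_lt, min_eq_right (by omega)]
  have hJ0 : J.Nonempty := Finset.card_pos.mp (hJcard ▸ hm0)
  let p₀ : Fin n → ℝ := fun i => shiftedCDF m δ (fun _ => false) i
  let p₁ : Fin n → ℝ := fun i => shiftedCDF m δ (fun _ => true) i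
  have hpδ : ∀ i ∈ J, p₀ i + 2 * δ = p₁ i := by
    intro i hi
    simp only [p₀, p₁, shiftedCDF, if_pos ((hmemJ i).mp hi), if_true, Bool.false_eq_true, if_false]
    ring
  have hpJ : ∀ i ∉ J, p₀ i = p₁ i := by
    intro i hi
    simp only [p₀, p₁, shiftedCDF, if_neg (fun h => hi ((hmemJ i).mpr h))]
  have hpd : ∀ i, |p₁ i - p₀ i| ≤ 2 * δ := by
    intro i
    by_cases hi : i ∈ J
    · rw [← hpδ i hi, add_sub_cancel_left, abs_of_nonneg (by linarith)]
    · rw [hpJ i hi, sub_self, abs_zero]; linarith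
  have hex : ∀ B : Finset (Fin n), ∃ D : PMF (Fin (n + 1)),
      ∀ i, cdf D i = if i ∈ B then p₁ i else p₀ i := by
    intro B
    obtain ⟨D, hD⟩ := exists_pmf_cdf n (shiftedCDF m δ fun k => decide (k ∈ B.image Fin.val))
      (shiftedCDF_monotone hδ0 hmδ _)
      (by linarith [(shiftedCDF_mem hδ0 hmδ (fun k => decide (k ∈ B.image Fin.val)) 0).1])
      (fun k => by linarith [(shiftedCDF_mem hδ0 hmδ (fun k => decide (k ∈ B.image Fin.val)) k).2])
    refine ⟨D, fun i => ?_⟩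
    have hmem : (i : ℕ) ∈ B.image Fin.val ↔ i ∈ B := by simp [Fin.val_inj]
    rw [hD]
    by_cases hi : i ∈ B <;>
      simp only [p₀, p₁, shiftedCDF, hmem, hi, decide_true, decide_false, if_true, if_false]
  choose D hD using hex
  by_contra hcon
  push Not at hcon
  let g : Finset (Fin n) → List (Fin n × Bool) → ℝ := fun B o =>
    (A.estimate T o : Measure (Fin n → unitInterval)).real
      {G | ∀ i ∈ J, |(G i : ℝ) - if i ∈ B then p₁ i else p₀ i| < δ}
  have hsucc : ∀ B, 5 / 8 ≤ pathSum (playWeight A (D B) T) T fun h => g B (observed h) := by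
    intro B
    have h1 := (hcon (D B)).trans (successProb_le A (D B) T ε
      (fun h => g B (observed h) + ∑ i ∈ J, 1 / (ε * T) ^ 2 * (deviation (D B) i h ^ 2 + 0))
      fun h hh => by
        have := measureReal_ksDist_le
          (A.estimate T (observed h) : Measure (Fin n → unitInterval)) (D B) J hε hT hh
        simpa only [hD, ← hδ] using this)
    rw [pathSum_add, pathSum_sum_mul] at h1
    simp only [pathSum_deviation_sq] at h1
    -- Chebyshev with a union bound over the `m` points. The lower bound on `T` and `log m ≥ 16384`
    -- give `T ε² ≥ 2 m`, so the total is at most `1/8`.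
    have h2 : ∑ i ∈ J, 1 / (ε * T) ^ 2 * (T * (cdf (D B) i * (1 - cdf (D B) i)) + 0) ≤ 1 / 8 := by
      calc _ ≤ ∑ i ∈ J, 1 / (ε * T) ^ 2 * (T * (1 / 4)) := by
            refine Finset.sum_le_sum fun i _ => mul_le_mul_of_nonneg_left ?_ (by positivity)
            rw [add_zero]
            exact mul_le_mul_of_nonneg_left (by nlinarith [sq_nonneg (cdf (D B) i - 1 / 2)]) hTR.le
        _ = m / (4 * T * ε ^ 2) := by
            rw [Finset.sum_const, hJcard, nsmul_eq_mul]; field_simp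
        _ ≤ 1 / 8 := by
            rw [div_le_iff₀ (by positivity)]
            have := mul_le_mul_of_nonneg_left hm hmR.le
            nlinarith
    have h3 : (3 / 4 : ℝ≥0∞) = ENNReal.ofReal (3 / 4) := by
      rw [ENNReal.ofReal_div_of_pos (by norm_num)]; norm_num
    rw [h3, ENNReal.ofReal_le_ofReal_iff'] at h1
    rcases h1 with h1 | h1
    · linarith
    · norm_num at h1
  -- With `L = (m / 2) log m` the average potential per bit is `log m / 2`, so `m * exp (-L / m) =
  -- √m`.
  have hL : 0 < (m : ℝ) / 2 * Real.log m := by positivity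
  have havg := average_decoding_le A T hJ0 hL
    (fun i => shiftedCDF_mem hδ0 hmδ _ _) (fun i => shiftedCDF_mem hδ0 hmδ _ _) hpd hpJ D hD g
    (fun B o => measureReal_nonneg) (fun o => sum_measureReal_decode_le_one _ J δ p₀ p₁ hpδ)
  have hlow : (5 : ℝ) / 8 ≤ ∑ B ∈ J.powerset, (1 / 2) ^ J.card *
      pathSum (playWeight A (D B) T) T (fun h => g B (observed h)) := by
    calc (5 : ℝ) / 8 = ∑ B ∈ J.powerset, (1 / 2) ^ J.card * (5 / 8) := by
          rw [Finset.sum_const, Finset.card_powerset, nsmul_eq_mul]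
          push_cast
          rw [← mul_assoc, ← mul_pow]
          norm_num
      _ ≤ _ := Finset.sum_le_sum fun B _ => mul_le_mul_of_nonneg_left (hsucc B) (by positivity)
  have hexp : Real.exp (-(1 / 4 * ((J.card : ℝ) *
      Real.exp (-((m : ℝ) / 2 * Real.log m / J.card))))) ≤ 1 / 8 := by
    rw [hJcard]
    have h1 : (m : ℝ) * Real.exp (-((m : ℝ) / 2 * Real.log m / m)) = Real.exp (Real.log m / 2) := by
      nth_rewrite 1 [← Real.exp_log hmR]
      rw [← Real.exp_add]
      congr 1
      field_simp
      ring
    rw [h1, Real.exp_neg, inv_le_comm₀ (Real.exp_pos _) (by norm_num)]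
    have h2 := Real.add_one_le_exp (Real.log m / 2)
    have h3 := Real.add_one_le_exp (1 / 4 * Real.exp (Real.log m / 2))
    linarith
  -- By the upper bound on `T`, the ratio is at most `512 / 4096 = 1/8`. The final contradiction is
  -- `5/8 ≤ 1/8 + 1/8`.
  have hinfo : 64 * δ ^ 2 * T / ((m : ℝ) / 2 * Real.log m) ≤ 1 / 8 := by
    rw [div_le_iff₀ hL, hδ]
    linarith
  linarith

/-! ### Anticoncentration of the fair binomial distribution. -/

/-- The mean of `φ` under the binomial distribution with parameters `N` and `1 / 2`. -/
def binAvg (N : ℕ) (φ : ℕ → ℝ) : ℝ :=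
  ∑ k ∈ Finset.range (N + 1), (N.choose k : ℝ) / 2 ^ N * φ k

lemma binAvg_succ (N : ℕ) (φ : ℕ → ℝ) :
    binAvg (N + 1) φ = binAvg N fun k => (φ k + φ (k + 1)) / 2 := by
  have h1 : ∑ k ∈ Finset.range (N + 2), (N.choose k : ℝ) / 2 ^ N * φ k =
      ∑ k ∈ Finset.range (N + 1), (N.choose k : ℝ) / 2 ^ N * φ k := by
    rw [Finset.sum_range_succ]; simp
  rw [Finset.sum_range_succ'] at h1
  have h2 : binAvg N (fun k => (φ k + φ (k + 1)) / 2) =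
      (∑ k ∈ Finset.range (N + 1), (N.choose k : ℝ) / 2 ^ N * φ k +
        ∑ k ∈ Finset.range (N + 1), (N.choose k : ℝ) / 2 ^ N * φ (k + 1)) / 2 := by
    rw [binAvg, ← Finset.sum_add_distrib, Finset.sum_div]
    refine Finset.sum_congr rfl fun k _ => by ring
  rw [h2, ← h1, binAvg, Finset.sum_range_succ', add_right_comm, ← Finset.sum_add_distrib, add_div,
    Finset.sum_div]
  congr 1
  · refine Finset.sum_congr rfl fun k _ => ?_
    rw [Nat.choose_succ_succ, pow_succ]
    push_cast
    field_simp
    ring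
  · simp only [Nat.choose_zero_right, pow_succ]
    field_simp

lemma choose_succ_le_two_pow (N k : ℕ) : (N + 1).choose k ≤ 2 ^ N := by
  induction N generalizing k with
  | zero => rcases k with _ | _ | k <;> simp [Nat.choose_eq_zero_of_lt]
  | succ N ih =>
    cases k with
    | zero => simpa using Nat.one_le_two_pow
    | succ k =>
      rw [Nat.choose_succ_succ', pow_succ]
      have := ih k
      have := ih (k + 1)
      omega

/-- Induction using `(2m + 1)(2m + 3) ≤ 4 (m + 1)²`. It yields that no binomial atom exceeds `1 /
√N`. -/
lemma centralBinom_sq_mul_le (m : ℕ) : m.centralBinom ^ 2 * (2 * m + 1) ≤ 4 ^ (2 * m) := by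
  induction m with
  | zero => simp
  | succ m ih =>
    have h := Nat.succ_mul_centralBinom_succ m
    refine Nat.le_of_mul_le_mul_left ?_ (pow_pos (Nat.succ_pos m) 2)
    calc (m + 1) ^ 2 * ((m + 1).centralBinom ^ 2 * (2 * (m + 1) + 1))
        = ((m + 1) * (m + 1).centralBinom) ^ 2 * (2 * m + 3) := by ring
      _ = m.centralBinom ^ 2 * (2 * m + 1) * (4 * ((2 * m + 1) * (2 * m + 3))) := by
          rw [h]; ring
      _ ≤ 4 ^ (2 * m) * (4 * (4 * (m + 1) ^ 2)) := by
          refine Nat.mul_le_mul ih ?_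
          nlinarith
      _ = (m + 1) ^ 2 * 4 ^ (2 * (m + 1)) := by ring

lemma choose_sq_mul_le (N k : ℕ) : N.choose k ^ 2 * N ≤ 4 ^ N := by
  obtain ⟨m, rfl | rfl⟩ := Nat.even_or_odd' N
  · calc _ ≤ m.centralBinom ^ 2 * (2 * m + 1) :=
          Nat.mul_le_mul (Nat.pow_le_pow_left (Nat.choose_le_centralBinom k m) 2) (by omega)
      _ ≤ _ := centralBinom_sq_mul_le m
  · have h : (2 * m + 1).choose k ≤ 2 * m.centralBinom := by
      cases k with
      | zero =>
        have := Nat.centralBinom_pos m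
        rw [Nat.choose_zero_right]; omega
      | succ k =>
        rw [Nat.choose_succ_succ']
        have := Nat.choose_le_centralBinom k m
        have := Nat.choose_le_centralBinom (k + 1) m
        omega
    calc _ ≤ (2 * m.centralBinom) ^ 2 * (2 * m + 1) :=
          Nat.mul_le_mul_right _ (Nat.pow_le_pow_left h 2)
      _ = 4 * (m.centralBinom ^ 2 * (2 * m + 1)) := by ring
      _ ≤ 4 * 4 ^ (2 * m) := Nat.mul_le_mul_left _ (centralBinom_sq_mul_le m)
      _ = _ := by ring

/-- A window of half-width `w` has at most `2w + 1` integers. If `w < 1/2` it has at most one, of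
mass at most `1/2`; otherwise each has mass at most `1 / √N ≤ 1 / (8w)`, and `2w + 1 ≤ 4w`. -/
lemma binAvg_indicator_le (N : ℕ) (hN : 1 ≤ N) (a w : ℝ) (hw : w < 1 / 2 ∨ 64 * w ^ 2 ≤ N) :
    binAvg N (fun k => if |(k : ℝ) - a| ≤ w then 1 else 0) ≤ 1 / 2 := by
  obtain ⟨s, hs⟩ : ∃ s, s = (Finset.range (N + 1)).filter fun k : ℕ => |(k : ℝ) - a| ≤ w := ⟨_, rfl⟩
  have hsum : binAvg N (fun k => if |(k : ℝ) - a| ≤ w then 1 else 0) =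
      ∑ k ∈ s, (N.choose k : ℝ) / 2 ^ N := by
    rw [binAvg, hs, Finset.sum_filter]
    refine Finset.sum_congr rfl fun k _ => by split_ifs <;> simp
  rw [hsum]
  rcases s.eq_empty_or_nonempty with hse | hse
  · simp [hse]
  have hmem : ∀ k ∈ s, |(k : ℝ) - a| ≤ w := fun k hk => by
    rw [hs] at hk; exact (Finset.mem_filter.mp hk).2
  have hw0 : 0 ≤ w := (abs_nonneg _).trans (hmem _ hse.choose_spec)
  have hcard : (s.card : ℝ) ≤ 2 * w + 1 := by
    have h1 : s ⊆ Finset.Icc (s.min' hse) (s.max' hse) := fun k hk =>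
      Finset.mem_Icc.mpr ⟨s.min'_le k hk, s.le_max' k hk⟩
    have h2 := Finset.card_le_card h1
    rw [Nat.card_Icc] at h2
    have h3 : s.card + s.min' hse ≤ s.max' hse + 1 := by
      have := s.min'_le_max' hse
      omega
    have h4 : (s.card : ℝ) + (s.min' hse : ℕ) ≤ (s.max' hse : ℕ) + 1 := by exact_mod_cast h3
    have h5 := (abs_le.mp (hmem _ (s.min'_mem hse))).1
    have h6 := (abs_le.mp (hmem _ (s.max'_mem hse))).2
    linarith
  rcases lt_or_ge w (1 / 2) with hw2 | hw2
  · have h1 : s.card ≤ 1 := by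
      have : (s.card : ℝ) < 2 := by linarith
      have : s.card < 2 := by exact_mod_cast this
      omega
    have h2 : ∀ k ∈ s, (N.choose k : ℝ) / 2 ^ N ≤ 1 / 2 := by
      intro k _
      obtain ⟨M, rfl⟩ : ∃ M, N = M + 1 := ⟨N - 1, by omega⟩
      rw [div_le_iff₀ (by positivity), pow_succ]
      have : ((M + 1).choose k : ℝ) ≤ 2 ^ M := by exact_mod_cast choose_succ_le_two_pow M k
      linarith
    have h3 := Finset.sum_le_card_nsmul s _ _ h2
    rw [nsmul_eq_mul] at h3
    have : (s.card : ℝ) ≤ 1 := by exact_mod_cast h1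
    linarith
  · replace hw := hw.resolve_left (not_lt.mpr hw2)
    have h2 : ∀ k ∈ s, (N.choose k : ℝ) / 2 ^ N ≤ 1 / (8 * w) := by
      intro k _
      have h3 : (N.choose k : ℝ) ^ 2 * N ≤ 4 ^ N := by exact_mod_cast choose_sq_mul_le N k
      have h4 : (2 ^ N : ℝ) ^ 2 = 4 ^ N := by rw [← pow_mul, mul_comm, pow_mul]; norm_num
      rw [div_le_div_iff₀ (by positivity) (by positivity), one_mul]
      refine abs_le_of_sq_le_sq' ?_ (by positivity) |>.2
      rw [h4]
      calc ((N.choose k : ℝ) * (8 * w)) ^ 2 = (N.choose k : ℝ) ^ 2 * (64 * w ^ 2) := by ring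
        _ ≤ (N.choose k : ℝ) ^ 2 * N := mul_le_mul_of_nonneg_left hw (sq_nonneg _)
        _ ≤ _ := h3
    have h3 := Finset.sum_le_card_nsmul s _ _ h2
    rw [nsmul_eq_mul] at h3
    refine h3.trans ?_
    rw [mul_one_div, div_le_iff₀ (by positivity)]
    linarith

/-! ### The empirical CDF given the observations. -/

lemma fiberSum_integral {n : ℕ} {Ω : Type*} [MeasurableSpace Ω] (μ : Measure Ω)
    (D : PMF (Fin (n + 1))) (o : List (Fin n × Bool))
    (ψ : List (Fin (n + 1) × Fin n) → Ω → ℝ) (hψ : ∀ h, Integrable (ψ h) μ) :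
    fiberSum D o (fun h => ∫ G, ψ h G ∂μ) = ∫ G, fiberSum D o (fun h => ψ h G) ∂μ ∧
      Integrable (fun G => fiberSum D o fun h => ψ h G) μ := by
  induction o generalizing ψ with
  | nil => exact ⟨rfl, hψ []⟩
  | cons a o ih =>
    obtain ⟨q, y⟩ := a
    have hint : ∀ h, Integrable (fun G => ∑ x, (if decide (x ≤ q.castSucc) = y then (D x).toReal
        else 0) * ψ ((x, q) :: h) G) μ := fun h =>
      integrable_finsetSum _ fun x _ => (hψ _).const_mul _
    obtain ⟨h1, h2⟩ := ih _ hint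
    refine ⟨?_, h2⟩
    simp only [fiberSum]
    rw [← h1]
    congr 1
    funext h
    rw [integral_finsetSum _ fun x _ => (hψ _).const_mul _]
    refine Finset.sum_congr rfl fun x _ => (integral_const_mul _ _).symm

/-- The number of samples that are at most `i`. -/
def sampleCount {n : ℕ} (i : Fin n) (h : List (Fin (n + 1) × Fin n)) : ℕ :=
  h.countP fun r => decide (r.1 ≤ i.castSucc)

/-- `hstep` says that each observation either determines whether the sample counts at `i` or leaves
a fair coin. Hence, given all observations, the count is a constant plus a fair binomial variable
with one trial per coin. -/
lemma exists_fiberSum_sampleCount {n : ℕ} (D : PMF (Fin (n + 1))) (i : Fin n)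
    (coin : Fin n × Bool → Bool) (det : Fin n → Bool → ℕ) (w : Fin n → Bool → ℝ)
    (hstep : ∀ q y (φ : ℕ → ℝ), ∑ x, (if decide (x ≤ q.castSucc) = y then (D x).toReal else 0) *
      φ (if x ≤ i.castSucc then 1 else 0) =
        w q y * (if coin (q, y) then (φ 0 + φ 1) / 2 else φ (det q y)))
    (o : List (Fin n × Bool)) :
    ∃ C : ℕ, ∀ φ : ℕ → ℝ, fiberSum D o (fun h => φ (sampleCount i h)) =
      fiberSum D o (fun _ => 1) * binAvg (o.countP coin) fun k => φ (C + k) := by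
  induction o with
  | nil => exact ⟨0, fun φ => by simp [fiberSum, binAvg, sampleCount]⟩
  | cons a o ih =>
    obtain ⟨q, y⟩ := a
    obtain ⟨C, hC⟩ := ih
    have hone : fiberSum D ((q, y) :: o) (fun _ => 1) = w q y * fiberSum D o fun _ => 1 := by
      have := hstep q y fun _ => 1
      simp only [add_self_div_two, ite_self, mul_one] at this
      simp only [fiberSum, mul_one, this]
      simpa using fiberSum_const_mul D o (w q y) fun _ => 1
    have hcons : ∀ φ : ℕ → ℝ, fiberSum D ((q, y) :: o) (fun h => φ (sampleCount i h)) =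
        w q y * (fiberSum D o (fun _ => 1) * binAvg (o.countP coin) fun k =>
          if coin (q, y) then (φ (C + k) + φ (C + k + 1)) / 2 else φ (C + k + det q y)) := by
      intro φ
      rw [← hC fun c => if coin (q, y) then (φ c + φ (c + 1)) / 2 else φ (c + det q y),
        ← fiberSum_const_mul]
      simp only [fiberSum]
      congr 1
      funext h
      have := hstep q y fun u => φ (sampleCount i h + u)
      rw [add_zero] at this
      rw [← this]
      refine Finset.sum_congr rfl fun x _ => ?_
      simp only [sampleCount, List.countP_cons, decide_eq_true_eq]
    by_cases hc : coin (q, y) = true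
    · refine ⟨C, fun φ => ?_⟩
      rw [hcons, hone, List.countP_cons_of_pos hc, binAvg_succ, mul_assoc]
      simp only [hc, if_true, add_assoc]
    · refine ⟨C + det q y, fun φ => ?_⟩
      rw [hcons, hone, List.countP_cons_of_neg hc, mul_assoc]
      simp only [hc, Bool.false_eq_true, if_false]
      congr 3
      funext k
      rw [add_right_comm]

/-- Given the observations the estimate is independent of the hidden coins, so the order of
integration can be exchanged and anticoncentration applied to each fixed output `G`. -/
lemma fiberSum_measureReal_le {n : ℕ} (D : PMF (Fin (n + 1))) (i : Fin n)
    (coin : Fin n × Bool → Bool) (det : Fin n → Bool → ℕ) (w : Fin n → Bool → ℝ)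
    (hstep : ∀ q y (φ : ℕ → ℝ), ∑ x, (if decide (x ≤ q.castSucc) = y then (D x).toReal else 0) *
      φ (if x ≤ i.castSucc then 1 else 0) =
        w q y * (if coin (q, y) then (φ 0 + φ 1) / 2 else φ (det q y)))
    (o : List (Fin n × Bool)) (ho : 1 ≤ o.countP coin) {ε : ℝ}
    (hε : ε * o.length < 1 / 2 ∨ 64 * (ε * o.length) ^ 2 ≤ o.countP coin)
    (μ : Measure (Fin n → unitInterval)) [IsProbabilityMeasure μ] :
    fiberSum D o (fun h => μ.real {G | ksDist (fun i => (G i : ℝ)) (empiricalCDF h) ≤ ε}) ≤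
      fiberSum D o (fun _ => 1) * (1 / 2) := by
  have hlen : (0 : ℝ) < o.length := by
    have := ho.trans List.countP_le_length
    exact_mod_cast this
  -- Only the error at the single coordinate `i` is kept, scaled by the number of rounds.
  let S : List (Fin (n + 1) × Fin n) → Set (Fin n → unitInterval) := fun h =>
    {G | |(sampleCount i h : ℝ) - o.length * (G i : ℝ)| ≤ ε * o.length}
  have hS : ∀ h, MeasurableSet (S h) := fun h => measurableSet_le
    ((measurable_const.sub (measurable_const.mul
      (measurable_subtype_coe.comp (measurable_pi_apply i)))).abs) measurable_const
  calc _ ≤ fiberSum D o (fun h => ∫ G, (S h).indicator (fun _ => (1 : ℝ)) G ∂μ) := by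
        refine fiberSum_mono D o fun h hh => ?_
        have hl : h.length = o.length := by rw [← hh, observed, List.length_map]
        rw [integral_indicator_const _ (hS h), smul_eq_mul, mul_one]
        refine measureReal_mono fun G hG => ?_
        have h1 := abs_sub_le_of_ksDist_le hG i
        have h2 : (sampleCount i h : ℝ) - o.length * (G i : ℝ) =
            -(o.length * ((G i : ℝ) - empiricalCDF h i)) := by
          rw [empiricalCDF, sampleCount, hl]; field_simp; ring
        change |(sampleCount i h : ℝ) - o.length * (G i : ℝ)| ≤ ε * o.length
        rw [h2, abs_neg, abs_mul, abs_of_pos hlen, mul_comm]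
        exact mul_le_mul_of_nonneg_right h1 hlen.le
    _ = ∫ G, fiberSum D o (fun h => (S h).indicator (fun _ => (1 : ℝ)) G) ∂μ :=
        (fiberSum_integral μ D o _ fun h => (integrable_const 1).indicator (hS h)).1
    _ ≤ ∫ _, fiberSum D o (fun _ => 1) * (1 / 2) ∂μ := by
        refine integral_mono (fiberSum_integral μ D o _ fun h =>
          (integrable_const 1).indicator (hS h)).2 (integrable_const _) fun G => ?_
        obtain ⟨C, hC⟩ := exists_fiberSum_sampleCount D i coin det w hstep o
        have h1 := hC fun c => if |(c : ℝ) - o.length * (G i : ℝ)| ≤ ε * o.length then 1 else 0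
        have h2 := binAvg_indicator_le (o.countP coin) ho (o.length * (G i : ℝ) - C) _ hε
        have h3 : (fun h => (S h).indicator (fun _ => (1 : ℝ)) G) = fun h =>
            if |(sampleCount i h : ℝ) - o.length * (G i : ℝ)| ≤ ε * o.length then 1 else 0 := by
          funext h
          rw [Set.indicator_apply]
          rfl
        change fiberSum D o (fun h => (S h).indicator (fun _ => (1 : ℝ)) G) ≤ _
        rw [h3, h1]
        refine mul_le_mul_of_nonneg_left (le_of_eq_of_le ?_ h2) (fiberSum_one_nonneg D o)
        congr 1
        funext k
        push_cast
        rw [show (C : ℝ) + k - o.length * (G i : ℝ) = k - (o.length * (G i : ℝ) - C) by ring]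
    _ = _ := by simp

/-! ### The three-atom instance, giving a bound of order `1 / ε²`. -/

lemma exists_pmf_three_atoms {n : ℕ} (hn : 2 ≤ n) :
    ∃ D : PMF (Fin (n + 1)), ∀ f : Fin (n + 1) → ℝ, ∑ x, (D x).toReal * f x =
      1 / 3 * (f 0 + f ⟨1, by omega⟩ + f (Fin.last n)) := by
  let v : Fin (n + 1) → ℝ := fun x => (if x = 0 then 1 / 3 else 0) +
    (if x = ⟨1, by omega⟩ then 1 / 3 else 0) + if x = Fin.last n then 1 / 3 else 0
  have hv : ∀ x, 0 ≤ v x := fun x => by positivity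
  have hsum : ∀ f : Fin (n + 1) → ℝ, ∑ x, v x * f x =
      1 / 3 * (f 0 + f ⟨1, by omega⟩ + f (Fin.last n)) := by
    intro f
    simp only [v, add_mul, Finset.sum_add_distrib, ite_mul, zero_mul, Finset.sum_ite_eq',
      Finset.mem_univ, if_true]
    ring
  refine ⟨PMF.ofFintype (fun x => ENNReal.ofReal (v x)) ?_, fun f => ?_⟩
  · rw [← ENNReal.ofReal_sum_of_nonneg fun x _ => hv x]
    have := hsum fun _ => 1
    simp only [mul_one] at this
    rw [this]
    norm_num
  · simp only [PMF.ofFintype_apply, ENNReal.toReal_ofReal (hv _), hsum]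

/-- With the three atoms `0`, `1` and `n`, the feedback determines the sample. -/
def resolved {n : ℕ} (a : Fin n × Bool) : Bool := decide ((a.1 : ℕ) = 0) == a.2

/-- With the three atoms `0`, `1` and `n`, the feedback leaves the atoms `1` and `n`. -/
def upperCoin {n : ℕ} (a : Fin n × Bool) : Bool := decide ((a.1 : ℕ) = 0) && !a.2

/-- With the three atoms `0`, `1` and `n`, the feedback leaves the atoms `0` and `1`. -/
def lowerCoin {n : ℕ} (a : Fin n × Bool) : Bool := !decide ((a.1 : ℕ) = 0) && a.2

lemma countP_resolved_add {n : ℕ} (o : List (Fin n × Bool)) :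
    o.countP resolved + o.countP upperCoin + o.countP lowerCoin = o.length := by
  induction o with
  | nil => rfl
  | cons a o ih =>
    obtain ⟨q, y⟩ := a
    simp only [List.countP_cons, List.length_cons, ← ih]
    by_cases hq : (q : ℕ) = 0 <;> cases y <;>
      simp [resolved, upperCoin, lowerCoin, hq] <;> omega

/-- Whatever the query, exactly one of the three atoms is isolated by it: the atom `0` by the query
`0`, the atom `n` by any other query. -/
lemma pathSum_countP_resolved {n : ℕ} (hn : 2 ≤ n) (A : CDFAlgorithm n) {D : PMF (Fin (n + 1))}
    (hD : ∀ f : Fin (n + 1) → ℝ, ∑ x, (D x).toReal * f x =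
      1 / 3 * (f 0 + f ⟨1, by omega⟩ + f (Fin.last n))) (T t : ℕ) (c : ℝ) :
    pathSum (playWeight A D T) t (fun h => ((observed h).countP resolved : ℝ) + c) =
      t / 3 + c := by
  induction t generalizing c with
  | zero => simp [pathSum, observed]
  | succ t ih =>
    rw [pathSum]
    have : (fun h : List (Fin (n + 1) × Fin n) => ∑ a, playWeight A D T h a *
        (((observed (a :: h)).countP resolved : ℝ) + c)) =
        fun h => ((observed h).countP resolved : ℝ) + (c + 1 / 3) := by
      funext h
      have hobs : ∀ x q, observed ((x, q) :: h) = (q, decide (x ≤ q.castSucc)) :: observed h :=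
        fun x q => rfl
      simp only [Fintype.sum_prod_type, playWeight, hobs]
      rw [Finset.sum_comm]
      have hq : ∀ q, ∑ x, (D x).toReal * (A.query T (observed h) q).toReal *
          ((((q, decide (x ≤ q.castSucc)) :: observed h).countP resolved : ℝ) + c) =
          (A.query T (observed h) q).toReal *
            (((observed h).countP resolved : ℝ) + (c + 1 / 3)) := by
        intro q
        simp only [mul_assoc]
        rw [hD]
        have hlast : ¬ Fin.last n ≤ q.castSucc := by
          rw [Fin.le_def, Fin.val_last, Fin.val_castSucc]; omega
        by_cases hq : (q : ℕ) = 0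
        · have h1 : ¬ (⟨1, by omega⟩ : Fin (n + 1)) ≤ q.castSucc := by
            rw [Fin.le_def, Fin.val_castSucc]; simp [hq]
          simp [resolved, hq, hlast, h1]
          ring
        · have h1 : (⟨1, by omega⟩ : Fin (n + 1)) ≤ q.castSucc := by
            rw [Fin.le_def, Fin.val_castSucc]; exact Nat.pos_of_ne_zero hq
          simp [resolved, hq, hlast, h1]
          ring
      simp only [hq]
      rw [← Finset.sum_mul, sum_toReal_pmf, one_mul]
    rw [this, ih]
    push_cast
    ring

/-- This is `hstep` for the coordinate `1`: only the pair of atoms `1` and `n` is undecided there,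
since both atoms `0` and `1` count. `sum_three_atoms_lower` is its counterpart for the coordinate
`0`. -/
lemma sum_three_atoms_upper {n : ℕ} (hn : 2 ≤ n) {D : PMF (Fin (n + 1))}
    (hD : ∀ f : Fin (n + 1) → ℝ, ∑ x, (D x).toReal * f x =
      1 / 3 * (f 0 + f ⟨1, by omega⟩ + f (Fin.last n))) (q : Fin n) (y : Bool) (φ : ℕ → ℝ) :
    ∑ x, (if decide (x ≤ q.castSucc) = y then (D x).toReal else 0) *
      φ (if x ≤ (⟨1, by omega⟩ : Fin n).castSucc then 1 else 0) =
    (if resolved (q, y) then 1 / 3 else 2 / 3) *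
      (if upperCoin (q, y) then (φ 0 + φ 1) / 2 else φ (if y then 1 else 0)) := by
  have : ∀ x, (if decide (x ≤ q.castSucc) = y then (D x).toReal else 0) *
      φ (if x ≤ (⟨1, by omega⟩ : Fin n).castSucc then 1 else 0) =
      (D x).toReal * ((if decide (x ≤ q.castSucc) = y then 1 else 0) *
        φ (if x ≤ (⟨1, by omega⟩ : Fin n).castSucc then 1 else 0)) := by
    intro x; split_ifs <;> ring
  simp only [this]
  rw [hD]
  have hlast : ¬ Fin.last n ≤ q.castSucc := by
    rw [Fin.le_def, Fin.val_last, Fin.val_castSucc]; omega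
  have hlast' : ¬ Fin.last n ≤ (⟨1, by omega⟩ : Fin n).castSucc := by
    rw [Fin.le_def, Fin.val_last, Fin.val_castSucc]; simp; omega
  have h11 : (⟨1, by omega⟩ : Fin (n + 1)) ≤ (⟨1, by omega⟩ : Fin n).castSucc := le_rfl
  by_cases hq : (q : ℕ) = 0
  · have h1 : ¬ (⟨1, by omega⟩ : Fin (n + 1)) ≤ q.castSucc := by
      rw [Fin.le_def, Fin.val_castSucc]; simp [hq]
    cases y <;> simp only [resolved, upperCoin, hq, hlast, hlast', h1, h11, Fin.zero_le,
      decide_true, decide_false, if_true, if_false, Bool.false_eq_true, Bool.true_eq_false,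
      Bool.not_true, Bool.not_false, Bool.and_true, Bool.and_false, beq_iff_eq] <;> ring
  · have h1 : (⟨1, by omega⟩ : Fin (n + 1)) ≤ q.castSucc := by
      rw [Fin.le_def, Fin.val_castSucc]; exact Nat.pos_of_ne_zero hq
    cases y <;> simp only [resolved, upperCoin, hq, hlast, hlast', h1, h11, Fin.zero_le,
      decide_true, decide_false, if_true, if_false, Bool.false_eq_true, Bool.true_eq_false,
      Bool.not_true, Bool.not_false, Bool.and_true, Bool.and_false, beq_iff_eq] <;> ring

lemma sum_three_atoms_lower {n : ℕ} (hn : 2 ≤ n) {D : PMF (Fin (n + 1))}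
    (hD : ∀ f : Fin (n + 1) → ℝ, ∑ x, (D x).toReal * f x =
      1 / 3 * (f 0 + f ⟨1, by omega⟩ + f (Fin.last n))) (q : Fin n) (y : Bool) (φ : ℕ → ℝ) :
    ∑ x, (if decide (x ≤ q.castSucc) = y then (D x).toReal else 0) *
      φ (if x ≤ (⟨0, by omega⟩ : Fin n).castSucc then 1 else 0) =
    (if resolved (q, y) then 1 / 3 else 2 / 3) *
      (if lowerCoin (q, y) then (φ 0 + φ 1) / 2 else φ (if y then 1 else 0)) := by
  have : ∀ x, (if decide (x ≤ q.castSucc) = y then (D x).toReal else 0) *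
      φ (if x ≤ (⟨0, by omega⟩ : Fin n).castSucc then 1 else 0) =
      (D x).toReal * ((if decide (x ≤ q.castSucc) = y then 1 else 0) *
        φ (if x ≤ (⟨0, by omega⟩ : Fin n).castSucc then 1 else 0)) := by
    intro x; split_ifs <;> ring
  simp only [this]
  rw [hD]
  have hlast : ¬ Fin.last n ≤ q.castSucc := by
    rw [Fin.le_def, Fin.val_last, Fin.val_castSucc]; omega
  have hlast' : ¬ Fin.last n ≤ (⟨0, by omega⟩ : Fin n).castSucc := by
    rw [Fin.le_def, Fin.val_last, Fin.val_castSucc]; simp; omega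
  have h11 : ¬ (⟨1, by omega⟩ : Fin (n + 1)) ≤ (⟨0, by omega⟩ : Fin n).castSucc := by
    rw [Fin.le_def, Fin.val_castSucc]; simp
  by_cases hq : (q : ℕ) = 0
  · have h1 : ¬ (⟨1, by omega⟩ : Fin (n + 1)) ≤ q.castSucc := by
      rw [Fin.le_def, Fin.val_castSucc]; simp [hq]
    cases y <;> simp only [resolved, lowerCoin, hq, hlast, hlast', h1, h11, Fin.zero_le,
      decide_true, decide_false, if_true, if_false, Bool.false_eq_true, Bool.true_eq_false,
      Bool.not_true, Bool.and_true, Bool.and_false, beq_iff_eq] <;> ring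
  · have h1 : (⟨1, by omega⟩ : Fin (n + 1)) ≤ q.castSucc := by
      rw [Fin.le_def, Fin.val_castSucc]; exact Nat.pos_of_ne_zero hq
    cases y <;> simp only [resolved, lowerCoin, hq, hlast, hlast', h1, h11, Fin.zero_le,
      decide_true, decide_false, if_true, if_false, Bool.false_eq_true, Bool.true_eq_false,
      Bool.not_false, Bool.and_true, Bool.and_false, beq_iff_eq] <;> ring

/-- Unless at least `9/10` of the rounds are resolved, one of the two kinds of coin occurs at least
`T / 20` times and success has conditional probability at most `1/2`. As only a third of the rounds
are resolved on average, total success stays below `3/4`. -/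
lemma exists_successProb_lt_of_small {n : ℕ} (hn : 2 ≤ n) (A : CDFAlgorithm n) {ε : ℝ} {T : ℕ}
    (hT : 1 ≤ T) (hεT : ε * T < 1 / 2 ∨ 1280 * (ε * T) ^ 2 ≤ T) :
    ∃ D, successProb A (stochasticAdversary D) T ε < 3 / 4 := by
  obtain ⟨D, hD⟩ := exists_pmf_three_atoms hn
  refine ⟨D, ?_⟩
  have hTR : (0 : ℝ) < T := by exact_mod_cast hT
  refine (successProb_le A D T ε _ fun h _ => le_rfl).trans_lt ?_
  have h34 : (3 / 4 : ℝ≥0∞) = ENNReal.ofReal (3 / 4) := by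
    rw [ENNReal.ofReal_div_of_pos (by norm_num)]; norm_num
  rw [h34, ENNReal.ofReal_lt_ofReal_iff (by norm_num), pathSum_play_eq]
  have hpoint : ∀ o : List (Fin n × Bool), o.length = T →
      fiberSum D o (fun h => (A.estimate T (observed h) : Measure (Fin n → unitInterval)).real
        {G | ksDist (fun i => (G i : ℝ)) (empiricalCDF h) ≤ ε}) ≤
      -- The affine function of the resolved count equal to `1/2` at `0` and to `1` at `9T / 10`, so
      -- it dominates the conditional success probability. Its mean is `37/54 < 3/4`.
      fiberSum D o fun h => 5 / (9 * T) * (((observed h).countP resolved : ℝ) + 9 / 10 * T) := by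
    intro o ho
    have hrhs : fiberSum D o (fun h =>
        5 / (9 * T) * (((observed h).countP resolved : ℝ) + 9 / 10 * T)) =
        5 / (9 * T) * ((o.countP resolved : ℝ) + 9 / 10 * T) * fiberSum D o fun _ => 1 := by
      rw [← fiberSum_const_mul]
      exact fiberSum_congr D o fun h hh => by rw [hh, mul_one]
    have hlhs : fiberSum D o (fun h =>
        (A.estimate T (observed h) : Measure (Fin n → unitInterval)).real
          {G | ksDist (fun i => (G i : ℝ)) (empiricalCDF h) ≤ ε}) = fiberSum D o fun h =>
        (A.estimate T o : Measure (Fin n → unitInterval)).real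
          {G | ksDist (fun i => (G i : ℝ)) (empiricalCDF h) ≤ ε} :=
      fiberSum_congr D o fun h hh => by rw [hh]
    have hpos := fiberSum_one_nonneg D o
    rw [hrhs, hlhs]
    have hcount : (o.countP resolved : ℝ) + o.countP upperCoin + o.countP lowerCoin = T := by
      rw [← ho]; exact_mod_cast countP_resolved_add o
    have hhalf : fiberSum D o (fun _ => 1) * (1 / 2) ≤
        5 / (9 * T) * ((o.countP resolved : ℝ) + 9 / 10 * T) * fiberSum D o fun _ => 1 := by
      have h1 : 5 / (9 * T) * ((o.countP resolved : ℝ) + 9 / 10 * T) =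
          5 / (9 * T) * (o.countP resolved : ℝ) + 1 / 2 := by field_simp; ring
      have h2 : 0 ≤ 5 / (9 * (T : ℝ)) * (o.countP resolved : ℝ) := by positivity
      rw [h1, mul_comm]
      exact mul_le_mul_of_nonneg_right (by linarith) hpos
    rcases le_or_gt (9 / 10 * (T : ℝ)) (o.countP resolved) with hr | hr
    · have h1 : 1 ≤ 5 / (9 * T) * ((o.countP resolved : ℝ) + 9 / 10 * T) := by
        rw [div_mul_eq_mul_div, one_le_div (by positivity)]
        linarith
      calc _ ≤ fiberSum D o fun _ => 1 := fiberSum_mono D o fun h _ => measureReal_le_one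
        _ ≤ _ := le_mul_of_one_le_left hpos h1
    · refine le_trans ?_ hhalf
      rcases le_or_gt ((T : ℝ) / 20) (o.countP upperCoin) with hu | hu
      · refine fiberSum_measureReal_le D ⟨1, by omega⟩ upperCoin _ _
          (sum_three_atoms_upper hn hD) o ?_ ?_ _
        · have : (0 : ℝ) < o.countP upperCoin := by linarith
          exact_mod_cast this
        · rw [ho]
          exact hεT.imp_right fun h => by linarith
      · have hl : (T : ℝ) / 20 ≤ o.countP lowerCoin := by linarith
        refine fiberSum_measureReal_le D ⟨0, by omega⟩ lowerCoin _ _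
          (sum_three_atoms_lower hn hD) o ?_ ?_ _
        · have : (0 : ℝ) < o.countP lowerCoin := by linarith
          exact_mod_cast this
        · rw [ho]
          exact hεT.imp_right fun h => by linarith
  refine (pathSum_mono (queryWeight_nonneg A T) T hpoint).trans_lt ?_
  rw [← pathSum_play_eq, pathSum_const_mul, pathSum_countP_resolved hn A hD]
  have : 5 / (9 * (T : ℝ)) * (T / 3 + 9 / 10 * T) = 37 / 54 := by field_simp; norm_num
  rw [this]
  norm_num

/-! ### From failing horizons to the query complexity. -/

lemma ofReal_le_queryComplexity {n : ℕ} (A : CDFAlgorithm n) {ε x : ℝ} {T : ℕ} (hx : x ≤ T)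
    (h : ∃ D, successProb A (stochasticAdversary D) T ε < 3 / 4) :
    ENNReal.ofReal x ≤ ((queryComplexity A (stochasticAdversaries n) ε : ℕ∞) : ℝ≥0∞) := by
  obtain ⟨D, hD⟩ := h
  calc ENNReal.ofReal x ≤ ENNReal.ofReal T := ENNReal.ofReal_le_ofReal hx
    _ = ((T : ℕ∞) : ℝ≥0∞) := by simp
    _ ≤ _ := ENat.toENNReal_le.mpr (le_queryComplexity A T ε D hD)

lemma queryComplexity_ge_of_small {n : ℕ} (hn : 2 ≤ n) (A : CDFAlgorithm n) {ε : ℝ} (hε : 0 < ε)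
    (hεn : ε ≤ 1 / ((n : ℝ) + 1)) :
    ENNReal.ofReal (1 / 2560 / ε ^ 2) ≤
      ((queryComplexity A (stochasticAdversaries n) ε : ℕ∞) : ℝ≥0∞) := by
  have hX : 0 < 1 / 2560 / ε ^ 2 := by positivity
  have hε3 : ε ≤ 1 / 3 := by
    refine hεn.trans (one_div_le_one_div_of_le (by norm_num) ?_)
    have : (2 : ℝ) ≤ n := by exact_mod_cast hn
    linarith
  have hT1 : 1 ≤ ⌈1 / 2560 / ε ^ 2⌉₊ := Nat.ceil_pos.mpr hX
  refine ofReal_le_queryComplexity A (Nat.le_ceil _) (exists_successProb_lt_of_small hn A hT1 ?_)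
  have hlt := Nat.ceil_lt_add_one hX.le
  obtain ⟨T, hT⟩ : ∃ T, T = ⌈1 / 2560 / ε ^ 2⌉₊ := ⟨_, rfl⟩
  rw [← hT] at hT1 hlt ⊢
  -- When the ceiling is `1`, rounding up may break the quadratic condition, but then `ε T ≤ 1/3 <
  -- 1/2`. From `2` on, rounding at most doubles the value.
  rcases hT1.eq_or_lt with h1 | h1
  · left
    rw [← h1]
    push_cast
    linarith
  · right
    have h2 : (2 : ℝ) ≤ T := by exact_mod_cast h1
    have h3 : (T : ℝ) ≤ 2 * (1 / 2560 / ε ^ 2) := by linarith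
    have h4 : (T : ℝ) * ε ^ 2 ≤ 1 / 1280 := by
      calc (T : ℝ) * ε ^ 2 ≤ 2 * (1 / 2560 / ε ^ 2) * ε ^ 2 :=
            mul_le_mul_of_nonneg_right h3 (sq_nonneg _)
        _ = 1 / 1280 := by field_simp; norm_num
    nlinarith

lemma queryComplexity_ge_of_large {n m : ℕ} (A : CDFAlgorithm n) {ε : ℝ} (hε : 0 < ε)
    (hεn : ε ≤ 1 / ((n : ℝ) + 1)) (hmn : 8 * m ≤ n + 1) (hm : 16384 ≤ Real.log m) :
    ENNReal.ofReal (m * Real.log m / (8192 * ε ^ 2)) ≤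
      ((queryComplexity A (stochasticAdversaries n) ε : ℕ∞) : ℝ≥0∞) := by
  have hm1 : (1 : ℝ) ≤ m := by
    rcases Nat.eq_zero_or_pos m with rfl | h
    · norm_num at hm
    · exact_mod_cast h
  have hmlog : 16384 ≤ m * Real.log m := by nlinarith
  have hε1 : ε ≤ 1 := hεn.trans (by
    rw [div_le_one (by positivity)]
    linarith [Nat.cast_nonneg (α := ℝ) n])
  have hε2 : ε ^ 2 ≤ 1 := pow_le_one₀ hε.le hε1
  have hX : 1 ≤ m * Real.log m / (4096 * ε ^ 2) := by
    rw [one_le_div (by positivity)]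
    linarith
  have hle := Nat.floor_le (zero_le_one.trans hX)
  have hlt := Nat.lt_floor_add_one (m * Real.log m / (4096 * ε ^ 2))
  have hT1 : 1 ≤ ⌊m * Real.log m / (4096 * ε ^ 2)⌋₊ := Nat.floor_pos.mpr hX
  obtain ⟨T, hT⟩ : ∃ T, T = ⌊m * Real.log m / (4096 * ε ^ 2)⌋₊ := ⟨_, rfl⟩
  rw [← hT] at hle hlt hT1
  have hT1' : (1 : ℝ) ≤ T := by exact_mod_cast hT1
  rw [le_div_iff₀ (by positivity)] at hle
  rw [div_lt_iff₀ (by positivity)] at hlt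
  -- Rounding a number that is at least `1` down loses at most a factor `2`.
  have hge : m * Real.log m ≤ T * (8192 * ε ^ 2) := by nlinarith [sq_nonneg ε]
  refine ofReal_le_queryComplexity (T := T) A ?_
    (exists_successProb_lt_of_large A hε hεn hmn hm hle hge)
  rwa [div_le_iff₀ (by positivity)]

lemma exists_queryComplexity_ge : ∃ c : ℝ, 0 < c ∧
    ∀ (n : ℕ) (ε : ℝ), 1 ≤ n → 0 < ε → ε ≤ 1 / ((n : ℝ) + 1) → ∀ A : CDFAlgorithm n,
      ENNReal.ofReal (c * ((n : ℝ) * Real.log n / ε ^ 2)) ≤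
        ((queryComplexity A (stochasticAdversaries n) ε : ℕ∞) : ℝ≥0∞) := by
  obtain ⟨M, hM⟩ := exists_nat_ge (Real.exp 16384)
  obtain ⟨N, hN⟩ : ∃ N : ℝ, N = 8 * (M + 1) := ⟨_, rfl⟩
  have hN1 : 1 ≤ N := by rw [hN]; linarith [Nat.cast_nonneg (α := ℝ) M]
  -- `262144 = 16 * 2 * 8192` serves large `n`, through `n ≤ 16 m` and `log n ≤ 2 log m`; `N ^ 2`
  -- bounds `n log n` for the remaining `n`.
  refine ⟨1 / (262144 * N ^ 2), by positivity, fun n ε hn hε hεn A => ?_⟩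
  -- For `n = 1` the claimed bound is `0`, as `log 1 = 0`.
  rcases hn.eq_or_lt with rfl | hn2
  · simp
  have hnR : (2 : ℝ) ≤ n := by exact_mod_cast hn2
  have hlogn : 0 ≤ Real.log n := Real.log_nonneg (by linarith)
  rcases lt_or_ge ((n + 1) / 8) M with hsmall | hlarge
  · refine le_trans (ENNReal.ofReal_le_ofReal ?_) (queryComplexity_ge_of_small hn2 A hε hεn)
    have h1 : n ≤ 8 * (M + 1) := by omega
    have h2 : (n : ℝ) ≤ N := by rw [hN]; exact_mod_cast h1
    have h3 : Real.log n ≤ n := (Real.log_le_sub_one_of_pos (by linarith)).trans (by linarith)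
    have h4 : n * Real.log n ≤ N ^ 2 := by
      rw [sq]; exact mul_le_mul h2 (h3.trans h2) hlogn (by linarith)
    rw [← mul_div_assoc, div_le_div_iff_of_pos_right (by positivity), div_mul_eq_mul_div,
      div_le_div_iff₀ (by positivity) (by positivity)]
    nlinarith
  · obtain ⟨m, hm⟩ : ∃ m, m = (n + 1) / 8 := ⟨_, rfl⟩
    rw [← hm] at hlarge
    have hexp : Real.exp 16384 ≤ m := hM.trans (by exact_mod_cast hlarge)
    have hlog : 16384 ≤ Real.log m := by
      rw [Real.le_log_iff_exp_le (lt_of_lt_of_le (Real.exp_pos _) hexp)]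
      exact hexp
    refine le_trans (ENNReal.ofReal_le_ofReal ?_)
      (queryComplexity_ge_of_large (m := m) A hε hεn (by omega) hlog)
    have hm16 : (16 : ℝ) ≤ m := by linarith [Real.add_one_le_exp (16384 : ℝ)]
    have h1 : n ≤ 16 * m := by
      have : 16 ≤ m := by exact_mod_cast hm16
      omega
    have h2 : (n : ℝ) ≤ 16 * m := by exact_mod_cast h1
    have h3 : Real.log n ≤ 2 * Real.log m := by
      calc Real.log n ≤ Real.log (m ^ 2) := Real.log_le_log (by linarith) (by nlinarith)
        _ = 2 * Real.log m := by rw [Real.log_pow]; norm_num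
    have h4 : n * Real.log n ≤ 16 * m * (2 * Real.log m) := mul_le_mul h2 h3 hlogn (by linarith)
    calc 1 / (262144 * N ^ 2) * (n * Real.log n / ε ^ 2)
        ≤ 1 / 262144 * (16 * m * (2 * Real.log m) / ε ^ 2) := by
          refine mul_le_mul ?_ (div_le_div_of_nonneg_right h4 (sq_nonneg ε)) (by positivity)
            (by norm_num)
          exact one_div_le_one_div_of_le (by norm_num) (by nlinarith)
      _ = m * Real.log m / (8192 * ε ^ 2) := by field_simp; norm_num

end

end ComparisonFeedback

theorem mainTheorem3 :
    (∃ c : ℝ, 0 < c ∧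
      ∀ (n : ℕ) (ε : ℝ), 1 ≤ n → 0 < ε → ε ≤ 1 / ((n : ℝ) + 1) →
        ∀ A : ComparisonFeedback.CDFAlgorithm n,
          ENNReal.ofReal (c * ((n : ℝ) * Real.log n / ε ^ 2)) ≤
            ((ComparisonFeedback.queryComplexity A
              (ComparisonFeedback.stochasticAdversaries n) ε : ℕ∞) : ℝ≥0∞)) ∧
    (∀ (n : ℕ → ℕ) (ε : ℕ → ℝ),
      (∀ k, 2 ≤ n k ∧ 0 < ε k ∧ ε k ≤ 1 / ((n k : ℝ) + 1)) →
        ∀ A : (k : ℕ) → ComparisonFeedback.CDFAlgorithm (n k),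
          ¬ Tendsto
            (fun k =>
              ((ComparisonFeedback.queryComplexity (A k)
                (ComparisonFeedback.stochasticAdversaries (n k)) (ε k) : ℕ∞) : ℝ≥0∞) /
                ENNReal.ofReal ((n k : ℝ) * Real.log (n k) / ε k ^ 2))
            atTop (𝓝 0)) := by
  obtain ⟨c, hc, hbound⟩ := ComparisonFeedback.exists_queryComplexity_ge
  refine ⟨⟨c, hc, hbound⟩, fun n ε hnε A hlim => ?_⟩
  have hge : ∀ k, ENNReal.ofReal c ≤ ((ComparisonFeedback.queryComplexity (A k)
      (ComparisonFeedback.stochasticAdversaries (n k)) (ε k) : ℕ∞) : ℝ≥0∞) /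
        ENNReal.ofReal ((n k : ℝ) * Real.log (n k) / ε k ^ 2) := by
    intro k
    obtain ⟨hn, hε, hεn⟩ := hnε k
    have hn2 : (2 : ℝ) ≤ n k := by exact_mod_cast hn
    have hlog : 0 < Real.log (n k) := Real.log_pos (by linarith)
    have hpos : 0 < (n k : ℝ) * Real.log (n k) / ε k ^ 2 := by positivity
    rw [ENNReal.le_div_iff_mul_le (Or.inl (ENNReal.ofReal_pos.mpr hpos).ne')
      (Or.inl ENNReal.ofReal_ne_top), ← ENNReal.ofReal_mul hc.le]
    exact hbound _ _ (by omega) hε hεn _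
  have h0 : ENNReal.ofReal c ≤ 0 := ge_of_tendsto' hlim hge
  exact absurd h0 (not_le.mpr (ENNReal.ofReal_pos.mpr hc))
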